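/- **The calculus.** QIR expressions, up to renaming of bound variables, are: variables, $\lambda x.\,e$, applications $e_1\,e_2$; constants (64-bit numbers, strings, Booleans); $\mathbf{nil}$, $\mathbf{cons}\ e_1\ e_2$, $\mathbf{tnil}$, $\mathbf{tcons}\ s\ e_1\ e_2$ ($s$ a string), $\mathbf{ldestr}\ e_1\ e_2\ e_3$, $\mathbf{tdestr}\ e\ s$; $\mathbf{if}\ e_1\ \mathbf{then}\ e_2\ \mathbf{else}\ e_3$, $e_1\wedge e_2$, $e_1\vee e_2$, primitive functions $f(e)$, $f(e_1,e_2)$ on values; built-in functions $g(e)$, data references, external (Truffle) references; and the operators $\mathrm{scan}_c()$, $\mathrm{select}_c(e)$, $\mathrm{project}_c(e)$, $\mathrm{sort}_c(e)$, $\mathrm{topk}_c(e)$, $\mathrm{group}_{c,c'}(e)$, $\mathrm{join}_c(e,e')$, with configurations in subscript and children in parentheses. One-step reduction $\to$ contracts one redex in an arbitrary context; the rules are $(\lambda x.\,e_1)\,e_2\to e_1\{e_2/x\}$; $\mathbf{ldestr}\ \mathbf{nil}\ e_1\ e_2\to e_1$; $\mathbf{ldestr}\,(\mathbf{cons}\ h\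 t)\ e_1\ e_2\to e_2\,h\,t$; $\mathbf{tdestr}\,(\mathbf{tcons}\ s\ v\ t)\ s\to v$; $\mathbf{tdestr}\,(\mathbf{tcons}\ s'\ v\ t)\ s\to\mathbf{tdestr}\ t\ s$ if $s'\ne s$; the usual rules for $\mathbf{if}$ on a Boolean constant, and for $\wedge$, $\vee$ whose first argument is a Boolean constant; and $f(\text{constants})\to$ a constant, according to a fixed partial interpretation of each primitive function $f$. **Measure.** A database specifies which kinds of operators it supports and which expressions it supports as configurations of each kind of operator. An operator is *compatible* if its kind and all its configurations are supported; all other expressions are incompatible. A *fragment* of $e$ is a maximal context in $e$ made only of compatible operators. Let $M(e)=(\#\text{operators}-\#\text{compatible operators},\ \#\text{fragments})\in\mathbb N^2$, ordered lexicographically. $\mathrm{MinReds}(e)$ is the set of the $e'$ with $e\to^*e'$ whose measure is minimal among the reducts of $e$. **Hypotheses.** Attach unique identifiers to the operators of an expression and propagate them along reductions; the *occurrences* in a reduct of an operator are the operators with its identifier. An expression has *fixed operators* if no operator in it can be erased or duplicated, that is, along every reduction chain every operator keeps exactly one occurrence. The database has *stable compatibility* if, for every expression, all occurrences in all its reducts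 of a compatible operator are compatible. **The heuristic.** Fix a whole expression $e$. Each of the following functions takes a subexpression of $e$ and returns the expression obtained from $e$ by contracting one redex, or fails. * $\mathrm{MakeRedex}(e')$: contract $e'$ if it is a redex. Otherwise call $\mathrm{MakeRedex}(e'')$ if $e'$ is $e''\,e_1$, $\mathbf{ldestr}\ e''\ e_1\ e_2$, $\mathbf{tdestr}\ e''\ s$, $\mathbf{if}\ e''\ \mathbf{then}\ e_1\ \mathbf{else}\ e_2$, $e''\wedge e_1$, $e''\vee e_1$ or $f(e'')$, and for $e'=f(e_1,e_2)$ with $e''=e_1$ if $e_1$ is not a constant and $e''=e_2$ if it is; call $\mathrm{InlineVar}(e')$ if $e'$ is a variable; fail otherwise. * $\mathrm{InlineVar}(v)$: fail if $v$ is free in $e$, otherwise call $\mathrm{ContractLam}$ on the $\lambda$ that binds $v$. * $\mathrm{ContractLam}(e')$: call $\mathrm{MakeRedex}$ on the parent of $e'$ if that is an application, $\mathbf{ldestr}$, $\mathbf{tdestr}$, $\mathbf{if}$, $\wedge$, $\vee$ or a primitive function; call $\mathrm{ContractLam}$ on the parent if that is a $\lambda$, $\mathbf{cons}$ or $\mathbf{tcons}$;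 fail otherwise. For an operator $o$ of $e$, the *pass-1 move* returns $\mathrm{InlineVar}(v)$ for the first variable $v$ (from left to right) that is free in a configuration of $o$ and for which this does not fail; if there is none, it contracts the first (leftmost outermost) redex in the configurations of $o$; if there is none, it fails. The *pass-2 move* returns $\mathrm{MakeRedex}(c)$ for the first child $c$ of $o$ for which this does not fail, and fails if there is none. For $\Phi\in\mathbb N$, a pass on $e$ builds the tree with root $e$ and subtrees $T(\Phi,e,o)$ for the operators $o$ of $e$ in prefix order. Here, for $x$ the current candidate and $o$ an operator of the current expression, $T(\varphi,x,o)$ is the leaf $x$ if $\varphi=0$ or the move of the pass fails on $o$. Otherwise let $e'$ be the result of the move: if $M(e')<M(x)$ then $T(\varphi,x,o)$ has root $e'$ and subtrees $T(\Phi,e',o')$; if not, it has root $x$ and subtrees $T(\varphi-1,x,o')$; in both cases $o'$ ranges over the operators of $e'$ in prefix order. Then leaves with the same label as their parent are removed as long as possible; the result of the pass is the label of the leftmost leaf. $\mathrm{MinRed}_\Phi(e)$ is the result of pass 2 with fuel $\Phi$ on the result of pass 1 with fuel $\Phi$ on $e$. **Theorem.** For every database with stable compatibility and every strongly normalizing QIR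 expression $e$ with fixed operators, there is a fuel value $\Phi\in\mathbb N$ such that $\mathrm{MinRed}_\Phi(e)\in\mathrm{MinReds}(e)$. -/

import Mathlib

namespace QIR

/-! ## Syntax of the calculus -/

/-- Data values: 64-bit numbers, strings and Booleans. -/
inductive Value where
  | num (bits : BitVec 64)
  | str (s : String)
  | bool (b : Bool)

/-- The seven query operators. -/
inductive OpKind where
  | scan | select | project | sort | topk | group | join

/-- Number of configuration expressions of an operator. The configurations are written before the
child expressions; `group` has two of them, every other operator has one. -/
def OpKind.numConfigs : OpKind → ℕ
  | .group => 2
  | _ => 1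

/-- Nullary constructs. -/
inductive Sym0 where
  | const (v : Value)
  | lnil
  | tnil
  | dataRef (table : String)
  | truffle (id : ℕ)

/-- Unary constructs: `tdestr e name`, primitive functions on values (such as `- e`), built-in
functions (such as `avg e`) and `scan_e()`. Operators carry an identifier in `L`. -/
inductive Sym1 (L : Type) where
  | tdestr (name : String)
  | val (f : String)
  | builtin (g : String)
  | scan (id : L)

/-- Binary constructs: application, list and tuple constructors, the connectives, the other
primitive functions on values (such as `e₁ = e₂`), and the operators with one configuration and
one child. -/
inductive Sym2 (L : Type) where
  | app
  | lcons
  | tcons (name : String)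
  | and
  | or
  | val (f : String)
  | select (id : L)
  | project (id : L)
  | sort (id : L)
  | topk (id : L)

/-- Ternary constructs: `ldestr e eNil eCons`, `if e then e₁ else e₂`, `group_{eq,agg}(e)` and
`join_filter(e₁, e₂)`. -/
inductive Sym3 (L : Type) where
  | ldestr
  | ite
  | group (id : L)
  | join (id : L)

/-- Expressions up to renaming of bound variables (de Bruijn indices; an index that points beyond
all enclosing lambdas is a free variable). Every operator carries an identifier in `L`: QIR
expressions are `Expr Unit`, and `Expr ℕ` is used to follow operators along reductions. -/
inductive Expr (L : Type) where
  | var (n : ℕ)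
  | lam (body : Expr L)
  | leaf (s : Sym0)
  | un (s : Sym1 L) (a : Expr L)
  | bin (s : Sym2 L) (a b : Expr L)
  | tern (s : Sym3 L) (a b c : Expr L)

/-- Forgetting identifiers. -/
def Sym1.erase {L : Type} : Sym1 L → Sym1 Unit
  | .tdestr s => .tdestr s
  | .val f => .val f
  | .builtin g => .builtin g
  | .scan _ => .scan ()

/-- Forgetting identifiers. -/
def Sym2.erase {L : Type} : Sym2 L → Sym2 Unit
  | .app => .app
  | .lcons => .lcons
  | .tcons s => .tcons s
  | .and => .and
  | .or => .or
  | .val f => .val f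
  | .select _ => .select ()
  | .project _ => .project ()
  | .sort _ => .sort ()
  | .topk _ => .topk ()

/-- Forgetting identifiers. -/
def Sym3.erase {L : Type} : Sym3 L → Sym3 Unit
  | .ldestr => .ldestr
  | .ite => .ite
  | .group _ => .group ()
  | .join _ => .join ()

/-- Forgetting identifiers. -/
def Expr.erase {L : Type} : Expr L → Expr Unit
  | .var n => .var n
  | .lam b => .lam b.erase
  | .leaf s => .leaf s
  | .un s a => .un s.erase a.erase
  | .bin s a b => .bin s.erase a.erase b.erase
  | .tern s a b c => .tern s.erase a.erase b.erase c.erase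

/-- The kind and the identifier of an expression that is an operator. -/
def Expr.opInfo {L : Type} : Expr L → Option (OpKind × L)
  | .un (.scan i) _ => some (.scan, i)
  | .bin (.select i) _ _ => some (.select, i)
  | .bin (.project i) _ _ => some (.project, i)
  | .bin (.sort i) _ _ => some (.sort, i)
  | .bin (.topk i) _ _ => some (.topk, i)
  | .tern (.group i) _ _ _ => some (.group, i)
  | .tern (.join i) _ _ _ => some (.join, i)
  | _ => none

/-! ## Capture-avoiding substitution -/

/-- Extension of a renaming of indices under a binder. -/
def upRen (r : ℕ → ℕ) : ℕ → ℕ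
  | 0 => 0
  | n + 1 => r n + 1

/-- Renaming of the free indices. -/
def Expr.rename {L : Type} (r : ℕ → ℕ) : Expr L → Expr L
  | .var n => .var (r n)
  | .lam b => .lam (b.rename (upRen r))
  | .leaf s => .leaf s
  | .un s a => .un s (a.rename r)
  | .bin s a b => .bin s (a.rename r) (b.rename r)
  | .tern s a b c => .tern s (a.rename r) (b.rename r) (c.rename r)

/-- Extension of a simultaneous substitution under a binder. -/
def upSubst {L : Type} (σ : ℕ → Expr L) : ℕ → Expr L
  | 0 => .var 0
  | n + 1 => (σ n).rename Nat.succ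

/-- Simultaneous capture-avoiding substitution. -/
def Expr.subst {L : Type} (σ : ℕ → Expr L) : Expr L → Expr L
  | .var n => σ n
  | .lam b => .lam (b.subst (upSubst σ))
  | .leaf s => .leaf s
  | .un s a => .un s (a.subst σ)
  | .bin s a b => .bin s (a.subst σ) (b.subst σ)
  | .tern s a b c => .tern s (a.subst σ) (b.subst σ) (c.subst σ)

/-- `b.inst a` is the result of replacing the variable bound by `lam b` by `a` in `b`. -/
def Expr.inst {L : Type} (b a : Expr L) : Expr L :=
  b.subst fun n => match n with
    | 0 => a
    | n + 1 => .var n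

/-! ## Contexts and subexpressions -/

/-- One layer of a one-hole context. -/
inductive Frame (L : Type) where
  | lam
  | un (s : Sym1 L)
  | binL (s : Sym2 L) (b : Expr L)
  | binR (s : Sym2 L) (a : Expr L)
  | tern1 (s : Sym3 L) (b c : Expr L)
  | tern2 (s : Sym3 L) (a c : Expr L)
  | tern3 (s : Sym3 L) (a b : Expr L)

/-- Filling the hole of a layer. -/
def Frame.plug {L : Type} : Frame L → Expr L → Expr L
  | .lam, e => .lam e
  | .un s, e => .un s e
  | .binL s b, e => .bin s e b
  | .binR s a, e => .bin s a e
  | .tern1 s b c, e => .tern s e b c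
  | .tern2 s a c, e => .tern s a e c
  | .tern3 s a b, e => .tern s a b e

/-- One-hole contexts, as the list of their layers from the hole to the root. -/
abbrev Ctx (L : Type) := List (Frame L)

/-- `plug K e` is the expression `K[e]`. -/
def plug {L : Type} : Ctx L → Expr L → Expr L
  | [], e => e
  | f :: K, e => plug K (f.plug e)

/-- Number of lambdas on the path from the root to the hole. -/
def lamCount {L : Type} : Ctx L → ℕ
  | [] => 0
  | .lam :: K => lamCount K + 1
  | _ :: K => lamCount K

/-- Immediate subexpressions, from left to right, of the expression `e` located at `K`; each comes
with its location. -/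
def immediate {L : Type} (K : Ctx L) : Expr L → List (Ctx L × Expr L)
  | .var _ => []
  | .lam b => [(.lam :: K, b)]
  | .leaf _ => []
  | .un s a => [(.un s :: K, a)]
  | .bin s a b => [(.binL s b :: K, a), (.binR s a :: K, b)]
  | .tern s a b c => [(.tern1 s b c :: K, a), (.tern2 s a c :: K, b), (.tern3 s a b :: K, c)]

/-- All subexpressions of the expression `e` located at `K`, with their locations, in prefix
(depth-first, left-to-right) order. -/
def subexprs {L : Type} : Ctx L → Expr L → List (Ctx L × Expr L)
  | K, .var n => [(K, .var n)]
  | K, .lam b => (K, .lam b) :: subexprs (.lam :: K) b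
  | K, .leaf s => [(K, .leaf s)]
  | K, .un s a => (K, .un s a) :: subexprs (.un s :: K) a
  | K, .bin s a b => (K, .bin s a b) :: (subexprs (.binL s b :: K) a ++ subexprs (.binR s a :: K) b)
  | K, .tern s a b c => (K, .tern s a b c) :: (subexprs (.tern1 s b c :: K) a ++
      subexprs (.tern2 s a c :: K) b ++ subexprs (.tern3 s a b :: K) c)

/-- The operators of `e`, each with the context `C` such that `e = C[op]`. -/
def opPaths {L : Type} (e : Expr L) : List (Ctx L × Expr L) :=
  (subexprs [] e).filter fun p => p.2.opInfo.isSome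

/-- The configurations (with their locations) of the operator `o` located at `K`. -/
def opConfigs {L : Type} (K : Ctx L) (o : Expr L) : List (Ctx L × Expr L) :=
  match o.opInfo with
  | some (k, _) => (immediate K o).take k.numConfigs
  | none => []

/-- The child expressions (with their locations) of the operator `o` located at `K`. -/
def opChildren {L : Type} (K : Ctx L) (o : Expr L) : List (Ctx L × Expr L) :=
  match o.opInfo with
  | some (k, _) => (immediate K o).drop k.numConfigs
  | none => []

/-! ## Reduction -/

/-- The meaning of the strict primitive functions on values: the constant, if there is one, to
which a primitive function applied to constants reduces. -/
structure Prims where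
  un : String → Value → Option Value
  bin : String → Value → Value → Option Value

/-- The contraction rules at the root: `contract P e = some e'` if `e` is a redex that contracts to
`e'`, and `contract P e = none` if `e` is not a redex. -/
def contract {L : Type} (P : Prims) : Expr L → Option (Expr L)
  | .bin .app (.lam b) a => some (b.inst a)
  | .tern .ldestr (.leaf .lnil) n _ => some n
  | .tern .ldestr (.bin .lcons h t) _ c => some (.bin .app (.bin .app c h) t)
  | .un (.tdestr s) (.bin (.tcons s') v t) => some (if s' = s then v else .un (.tdestr s) t)
  | .tern .ite (.leaf (.const (.bool true))) a _ => some a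
  | .tern .ite (.leaf (.const (.bool false))) _ b => some b
  | .bin .and (.leaf (.const (.bool true))) b => some b
  | .bin .and (.leaf (.const (.bool false))) _ => some (.leaf (.const (.bool false)))
  | .bin .or (.leaf (.const (.bool true))) _ => some (.leaf (.const (.bool true)))
  | .bin .or (.leaf (.const (.bool false))) b => some b
  | .un (.val f) (.leaf (.const v)) => (P.un f v).map fun w => .leaf (.const w)
  | .bin (.val f) (.leaf (.const v)) (.leaf (.const w)) =>
      (P.bin f v w).map fun u => .leaf (.const u)
  | _ => none

/-- One-step reduction: contraction of a redex in an arbitrary context. -/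
def Step {L : Type} (P : Prims) (e e' : Expr L) : Prop :=
  ∃ (K : Ctx L) (r r' : Expr L), e = plug K r ∧ contract P r = some r' ∧ e' = plug K r'

/-- The reflexive, transitive closure of one-step reduction. -/
def Reduces {L : Type} (P : Prims) : Expr L → Expr L → Prop :=
  Relation.ReflTransGen (Step P)

/-- `e` is strongly normalizing: every reduction sequence starting from `e` is finite. -/
def StronglyNormalizing (P : Prims) (e : Expr Unit) : Prop :=
  Acc (fun a b => Step P b a) e

/-! ## Databases, the measure and the minimal reducts -/

/-- The capabilities of a database: the operators that it supports, and the expressions that it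
supports as a configuration of a given operator. -/
structure Database where
  supportsOp : OpKind → Prop
  supportsConfig : OpKind → Expr Unit → Prop

/-- `e` is a compatible operator: a supported operator all of whose configurations are supported.
Expressions that are not operators are incompatible. -/
def Compatible (D : Database) (e : Expr Unit) : Prop :=
  ∃ k : OpKind, e.opInfo = some (k, ()) ∧ D.supportsOp k ∧
    ∀ c ∈ opConfigs [] e, D.supportsConfig k c.2

/-- The number of operators of `e`. -/
def numOps (e : Expr Unit) : ℕ := (opPaths e).length

open Classical in
/-- The number of compatible operators of `e`. -/
noncomputable def numCompat (D : Database) (e : Expr Unit) : ℕ :=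
  ((opPaths e).filter fun p => decide (Compatible D p.2)).length

/-- `o`, located at `K`, is the root of a fragment: it is a compatible operator, and it is the whole
expression or its parent is incompatible. -/
def IsFragmentRoot (D : Database) (K : Ctx Unit) (o : Expr Unit) : Prop :=
  Compatible D o ∧
    match K with
    | [] => True
    | f :: _ => ¬ Compatible D (f.plug o)

open Classical in
/-- The number of fragments of `e`. A fragment is a maximal context made only of compatible
operators, so it is determined by the place of its root. -/
noncomputable def numFrags (D : Database) (e : Expr Unit) : ℕ :=
  ((opPaths e).filter fun p => decide (IsFragmentRoot D p.1 p.2)).length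

/-- The measure, ordered lexicographically. -/
noncomputable def measure (D : Database) (e : Expr Unit) : ℕ ×ₗ ℕ :=
  toLex (numOps e - numCompat D e, numFrags D e)

/-- The expressions obtained from `e` by exactly `n` reduction steps. -/
def reductionN (P : Prims) : ℕ → Expr Unit → Set (Expr Unit)
  | 0, e => {e}
  | n + 1, e => {e'' | ∃ e' ∈ reductionN P n e, Step P e' e''}

/-- The set of reducts of `e`. -/
def reductions (P : Prims) (e : Expr Unit) : Set (Expr Unit) := ⋃ n, reductionN P n e

/-- The set of reducts of `e` of minimal measure. -/
def minReductions (P : Prims) (D : Database) (e : Expr Unit) : Set (Expr Unit) :=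
  {e' | e' ∈ reductions P e ∧ ∀ e'' ∈ reductions P e, measure D e' ≤ measure D e''}

/-! ## Occurrences of operators, fixed operators, stable compatibility -/

/-- The identifiers of the operators of `f`, with multiplicity. -/
def opIds (f : Expr ℕ) : List ℕ :=
  (opPaths f).filterMap fun p => p.2.opInfo.map Prod.snd

/-- `f` is the expression `e` with a unique identifier attached to each operator. -/
def IsLabelling (f : Expr ℕ) (e : Expr Unit) : Prop :=
  f.erase = e ∧ (opIds f).Nodup

/-- The number of occurrences in `f` of the operator with identifier `i`. -/
def numOcc (i : ℕ) (f : Expr ℕ) : ℕ := (opIds f).count i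

/-- No operator of `e` can be erased or duplicated: identifiers being propagated along reductions,
no reduction chain from `e` leads to an expression in which some operator of `e` has no occurrence,
or more than one. -/
def FixedOperators (P : Prims) (e : Expr Unit) : Prop :=
  ∀ f : Expr ℕ, IsLabelling f e → ∀ i ∈ opIds f,
    (¬ ∃ f', Reduces P f f' ∧ numOcc i f' = 0) ∧ (¬ ∃ f', Reduces P f f' ∧ 1 < numOcc i f')

/-- Stable compatibility: if an operator of an expression is compatible, then so are all its
occurrences in all the reducts of this expression. -/
def StableCompatibility (P : Prims) (D : Database) : Prop :=
  ∀ (e : Expr Unit) (f f' : Expr ℕ), IsLabelling f e → Reduces P f f' →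
    ∀ p ∈ opPaths f, ∀ p' ∈ opPaths f',
      p'.2.opInfo.map Prod.snd = p.2.opInfo.map Prod.snd →
      Compatible D p.2.erase → Compatible D p'.2.erase

/-! ## The elementary moves of the heuristic

In the following definitions `K` and `e` stand for the subexpression `e` of `plug K e`. The result is
`none`, or the whole expression after the contraction of one redex. -/

/-- Number of nodes, used for termination only. -/
def Expr.size {L : Type} : Expr L → ℕ
  | .var _ => 1
  | .lam b => b.size + 1
  | .leaf _ => 1
  | .un _ a => a.size + 1
  | .bin _ a b => a.size + b.size + 1
  | .tern _ a b c => a.size + b.size + c.size + 1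

mutual

/-- Contract `e` if it is a redex, otherwise contract a redex that is necessary for `e` to become
one. -/
def makeRedex {L : Type} (P : Prims) (K : Ctx L) (e : Expr L) : Option (Expr L) :=
  match contract P e with
  | some e' => some (plug K e')
  | none =>
    match e with
    | .var n => inlineVar P n K (.var n)
    | .bin .app a b => makeRedex P (.binL .app b :: K) a
    | .tern .ldestr a b c => makeRedex P (.tern1 .ldestr b c :: K) a
    | .un (.tdestr s) a => makeRedex P (.un (.tdestr s) :: K) a
    | .tern .ite a b c => makeRedex P (.tern1 .ite b c :: K) a
    | .bin .and a b => makeRedex P (.binL .and b :: K) a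
    | .bin .or a b => makeRedex P (.binL .or b :: K) a
    | .un (.val f) a => makeRedex P (.un (.val f) :: K) a
    | .bin (.val f) (.leaf (.const v)) b => makeRedex P (.binR (.val f) (.leaf (.const v)) :: K) b
    | .bin (.val f) a b => makeRedex P (.binL (.val f) b :: K) a
    | _ => none
termination_by (lamCount K, 1, e.size)
decreasing_by all_goals simp [lamCount, Expr.size, Prod.lex_def]; try omega

/-- Contract the redex that `e` is a part of, otherwise contract a redex that is necessary for `e` to
become part of one. -/
def contractLam {L : Type} (P : Prims) (K : Ctx L) (e : Expr L) : Option (Expr L) :=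
  match K with
  | [] => none
  | .lam :: K => contractLam P K (.lam e)
  | .un (.tdestr s) :: K => makeRedex P K (.un (.tdestr s) e)
  | .un (.val f) :: K => makeRedex P K (.un (.val f) e)
  | .un _ :: _ => none
  | .binL .app b :: K => makeRedex P K (.bin .app e b)
  | .binL .and b :: K => makeRedex P K (.bin .and e b)
  | .binL .or b :: K => makeRedex P K (.bin .or e b)
  | .binL (.val f) b :: K => makeRedex P K (.bin (.val f) e b)
  | .binL .lcons b :: K => contractLam P K (.bin .lcons e b)
  | .binL (.tcons s) b :: K => contractLam P K (.bin (.tcons s) e b)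
  | .binL _ _ :: _ => none
  | .binR .app a :: K => makeRedex P K (.bin .app a e)
  | .binR .and a :: K => makeRedex P K (.bin .and a e)
  | .binR .or a :: K => makeRedex P K (.bin .or a e)
  | .binR (.val f) a :: K => makeRedex P K (.bin (.val f) a e)
  | .binR .lcons a :: K => contractLam P K (.bin .lcons a e)
  | .binR (.tcons s) a :: K => contractLam P K (.bin (.tcons s) a e)
  | .binR _ _ :: _ => none
  | .tern1 .ldestr b c :: K => makeRedex P K (.tern .ldestr e b c)
  | .tern1 .ite b c :: K => makeRedex P K (.tern .ite e b c)
  | .tern1 _ _ _ :: _ => none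
  | .tern2 .ldestr a c :: K => makeRedex P K (.tern .ldestr a e c)
  | .tern2 .ite a c :: K => makeRedex P K (.tern .ite a e c)
  | .tern2 _ _ _ :: _ => none
  | .tern3 .ldestr a b :: K => makeRedex P K (.tern .ldestr a b e)
  | .tern3 .ite a b :: K => makeRedex P K (.tern .ite a b e)
  | .tern3 _ _ _ :: _ => none
termination_by (lamCount K, 2, K.length)
decreasing_by all_goals simp_wf; simp [lamCount, Prod.lex_def]; try omega

/-- Walk up from `e` to the lambda that binds its free variable of index `n`, and call `contractLam`
on this lambda; the result is `none` if the variable is free in the whole expression. -/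
def inlineVar {L : Type} (P : Prims) (n : ℕ) (K : Ctx L) (e : Expr L) : Option (Expr L) :=
  match n, K with
  | _, [] => none
  | 0, .lam :: K => contractLam P K (.lam e)
  | n + 1, .lam :: K => inlineVar P n K (.lam e)
  | n, .un s :: K => inlineVar P n K (.un s e)
  | n, .binL s b :: K => inlineVar P n K (.bin s e b)
  | n, .binR s a :: K => inlineVar P n K (.bin s a e)
  | n, .tern1 s b c :: K => inlineVar P n K (.tern s e b c)
  | n, .tern2 s a c :: K => inlineVar P n K (.tern s a e c)
  | n, .tern3 s a b :: K => inlineVar P n K (.tern s a b e)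
termination_by (lamCount K, 0, K.length)
decreasing_by all_goals simp_wf; simp [lamCount, Prod.lex_def]; try omega

end

/-- The occurrences of variables in the configurations of the operator `o` located at `K` that are
free in the configuration, given by their locations and indices, from left to right. -/
def configFreeVars (K : Ctx Unit) (o : Expr Unit) : List (Ctx Unit × ℕ) :=
  (opConfigs K o).flatMap fun c => (subexprs c.1 c.2).filterMap fun p =>
    match p.2 with
    | .var n => if lamCount p.1 ≤ n + lamCount c.1 then some (p.1, n) else none
    | _ => none

/-- The results of the contraction of each of the redexes in the configurations of the operator `o`
located at `K`, in the prefix order of the redexes (the leftmost outermost redex comes first). -/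
def configContractions (P : Prims) (K : Ctx Unit) (o : Expr Unit) : List (Expr Unit) :=
  (opConfigs K o).flatMap fun c => (subexprs c.1 c.2).filterMap fun p =>
    (contract P p.2).map (plug p.1)

/-- One-step reduction of the configurations of the operator `o` located at `K`: inline the first free
variable that can be inlined; if there is none, contract the first redex. -/
def oneRedConfig (P : Prims) (K : Ctx Unit) (o : Expr Unit) : Option (Expr Unit) :=
  ((configFreeVars K o).filterMap (fun p => inlineVar P p.2 p.1 (.var p.2)) ++
    configContractions P K o).head?

/-- One-step reduction of the children of the operator `o` located at `K`: reduce the first child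
that can be reduced. -/
def oneRedChild (P : Prims) (K : Ctx Unit) (o : Expr Unit) : Option (Expr Unit) :=
  ((opChildren K o).filterMap fun c => makeRedex P c.1 c.2).head?

/-! ## Search spaces and the heuristic -/

/-- Finite ordered trees of expressions. -/
inductive Tree where
  | node (label : Expr Unit) (children : List Tree)

/-- The search space explored from the operator `p` of the current expression, with the remaining fuel
`φ`. The argument `next` is the one-step reduction of the current pass, `x` is the best expression
found so far on this branch (its current candidate), and `Φ` is the fuel that is available again each
time an expression of smaller measure than `x` is found. -/
noncomputable def searchTree (D : Database) (next : Ctx Unit → Expr Unit → Option (Expr Unit))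
    (Φ φ : ℕ) (x : Expr Unit) (p : Ctx Unit × Expr Unit) : Tree :=
  match φ, next p.1 p.2 with
  | 0, _ => .node x []
  | _ + 1, none => .node x []
  | φ + 1, some e' =>
    open Classical in
    if _h : measure D e' < measure D x then
      .node e' ((opPaths e').map fun q => searchTree D next Φ Φ e' q)
    else
      .node x ((opPaths e').map fun q => searchTree D next Φ φ x q)
termination_by (measure D x, φ)
decreasing_by
  · exact Prod.Lex.left _ _ _h
  · exact Prod.Lex.right _ (Nat.lt_succ_self _)

/-- The search space of a pass with fuel `Φ`. -/
noncomputable def searchSpace (D : Database) (next : Ctx Unit → Expr Unit → Option (Expr Unit))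
    (Φ : ℕ) (e : Expr Unit) : Tree :=
  .node e ((opPaths e).map fun p => searchTree D next Φ Φ e p)

open Classical in
mutual

/-- Rewrite `x(s₁, …, sᵢ, x(), sᵢ₊₂, …, sₙ)` to `x(s₁, …, sᵢ, sᵢ₊₂, …, sₙ)` as much as possible: remove
the subtrees that did not lead to an expression of smaller measure. -/
noncomputable def prune : Tree → Tree
  | .node x ts => .node x (pruneChildren x ts)

/-- The pruning of the children of a node with label `x`. -/
noncomputable def pruneChildren (x : Expr Unit) : List Tree → List Tree
  | [] => []
  | t :: ts =>
    match prune t with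
    | .node y [] =>
        if y = x then pruneChildren x ts else .node y [] :: pruneChildren x ts
    | .node y (u :: us) => .node y (u :: us) :: pruneChildren x ts

end

/-- The leftmost leaf of a tree. -/
def Tree.leftmostLeaf : Tree → Expr Unit
  | .node x [] => x
  | .node _ (t :: _) => t.leftmostLeaf

/-- The result of a pass. -/
noncomputable def passResult (D : Database) (next : Ctx Unit → Expr Unit → Option (Expr Unit))
    (Φ : ℕ) (e : Expr Unit) : Expr Unit :=
  (prune (searchSpace D next Φ e)).leftmostLeaf

/-- The result of the heuristic with fuel `Φ`: the first pass works on the configurations of the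
operators of `e`, the second pass on the children of the operators of the result of the first. -/
noncomputable def minRed (P : Prims) (D : Database) (Φ : ℕ) (e : Expr Unit) : Expr Unit :=
  passResult D (oneRedChild P) Φ (passResult D (oneRedConfig P) Φ e)

end QIR

namespace QIR

section

variable {L : Type}

/-! ## Renamings and substitutions -/

-- Attach identifiers to the operators. With fixed operators, every reduct has the same identifiers,
-- each exactly once, so reducts can be compared through sets of identifiers. Stable compatibility
-- makes the set of compatible operators grow along reductions. An operator immediately below
-- another operator stays there, since no redex can separate them; hence, as long as the set of
-- compatible operators does not change, the set of fragment roots can only shrink. So the measure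
-- never increases along a reduction (`measure_le_of_reduces`). Reduction is locally confluent,
-- hence confluent below a strongly normalizing expression (`reduces_join`). The result of the
-- heuristic and an arbitrary reduct therefore have a common reduct `w`, and it suffices to show
-- that `w` is not better than the result.
--
-- Sequences of moves have bounded length. With more fuel than this bound, a pass ends at an
-- expression from which no sequence of its moves improves the measure (`passResult_spec`).
--
-- The core is that a failing move certifies permanence. If `makeRedex` fails on a child, the root
-- symbol of the child can never change. If the first pass fails on an operator, its configurations
-- contain no redex and their free variables are never replaced, so the configurations stay the same
-- up to renaming (`stuck_of_fail`). These facts are carried along reductions by the invariant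
-- `AllOpSub`, which records at each place which variables are stuck.
--
-- Now let an operator be compatible in `w`. Apply the moves on it until they fail, at some `z`, and
-- join `z` with `w`. In the common reduct the operator is compatible, with the configurations it
-- had in `z` up to renaming. Stable compatibility implies that support of configurations is
-- invariant under renaming (`supportsConfig_rename`), so the operator was compatible in `z`
-- already. As moves did not improve the measure, it was compatible before them. The same argument
-- applies to an operator that is a configuration or a child of a compatible operator; hence the
-- measure of `w` is not smaller.

theorem upRen_comp (r r' : ℕ → ℕ) : upRen (r' ∘ r) = upRen r' ∘ upRen r := by
  funext n; cases n <;> rfl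

theorem rename_rename (e : Expr L) (r r' : ℕ → ℕ) :
    (e.rename r).rename r' = e.rename (r' ∘ r) := by
  induction e generalizing r r' <;> simp_all [Expr.rename, upRen_comp]

theorem upSubst_var (r : ℕ → ℕ) :
    (upSubst fun n => (Expr.var (r n) : Expr L)) = fun n => .var (upRen r n) := by
  funext n; cases n <;> rfl

theorem rename_eq_subst (e : Expr L) (r : ℕ → ℕ) :
    e.rename r = e.subst fun n => .var (r n) := by
  induction e generalizing r <;> simp_all [Expr.rename, Expr.subst, upSubst_var]

theorem upRen_id : upRen id = id := by
  funext n; cases n <;> rfl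

theorem rename_id (e : Expr L) : e.rename id = e := by
  induction e <;> simp_all [Expr.rename, upRen_id]

theorem subst_var (e : Expr L) : e.subst .var = e :=
  (rename_eq_subst e id).symm.trans (rename_id e)

theorem upSubst_comp_upRen (σ : ℕ → Expr L) (r : ℕ → ℕ) :
    (fun n => upSubst σ (upRen r n)) = upSubst fun n => σ (r n) := by
  funext n; cases n <;> rfl

theorem subst_rename_left (e : Expr L) (r : ℕ → ℕ) (σ : ℕ → Expr L) :
    (e.rename r).subst σ = e.subst fun n => σ (r n) := by
  induction e generalizing r σ <;> simp_all [Expr.rename, Expr.subst, upSubst_comp_upRen]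

theorem upSubst_rename (σ : ℕ → Expr L) (r : ℕ → ℕ) :
    (fun n => (upSubst σ n).rename (upRen r)) = upSubst fun n => (σ n).rename r := by
  funext n
  cases n with
  | zero => rfl
  | succ n =>
    simp only [upSubst, rename_rename]
    rfl

theorem subst_rename_right (e : Expr L) (r : ℕ → ℕ) (σ : ℕ → Expr L) :
    (e.subst σ).rename r = e.subst fun n => (σ n).rename r := by
  induction e generalizing r σ <;> simp_all [Expr.rename, Expr.subst, upSubst_rename]

theorem upSubst_subst (σ τ : ℕ → Expr L) :
    (fun n => (upSubst σ n).subst (upSubst τ)) = upSubst fun n => (σ n).subst τ := by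
  funext n
  cases n with
  | zero => rfl
  | succ n => simp only [upSubst, subst_rename_left, subst_rename_right]

theorem subst_subst (e : Expr L) (σ τ : ℕ → Expr L) :
    (e.subst σ).subst τ = e.subst fun n => (σ n).subst τ := by
  induction e generalizing σ τ <;> simp_all [Expr.subst, upSubst_subst]

/-- The substitution of `a` for the variable of index `0`. -/
def instSubst (a : Expr L) : ℕ → Expr L
  | 0 => a
  | n + 1 => .var n

theorem inst_eq (b a : Expr L) : b.inst a = b.subst (instSubst a) := by
  unfold Expr.inst
  congr 1

theorem inst_subst (b a : Expr L) (σ : ℕ → Expr L) :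
    (b.inst a).subst σ = (b.subst (upSubst σ)).inst (a.subst σ) := by
  simp only [inst_eq, subst_subst]
  congr 1
  funext n
  cases n with
  | zero => rfl
  | succ n =>
    simp only [instSubst, upSubst, subst_rename_left, Expr.subst]
    exact (subst_var _).symm

/-! ## Erasing identifiers -/

theorem erase_rename (e : Expr L) (r : ℕ → ℕ) : (e.rename r).erase = e.erase.rename r := by
  induction e generalizing r <;> simp_all [Expr.rename, Expr.erase]

theorem erase_subst (e : Expr L) (σ : ℕ → Expr L) :
    (e.subst σ).erase = e.erase.subst fun n => (σ n).erase := by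
  induction e generalizing σ with
  | lam b ih =>
    simp only [Expr.subst, Expr.erase, ih]
    congr 2
    funext n; cases n <;> simp [upSubst, Expr.erase, erase_rename]
  | _ => simp_all [Expr.subst, Expr.erase]

theorem erase_inst (b a : Expr L) : (b.inst a).erase = b.erase.inst a.erase := by
  simp only [inst_eq, erase_subst]
  congr 1
  funext n; cases n <;> rfl

/-- No rule inspects an identifier. This is what lets reductions and moves of unlabelled expressions
be lifted to labelled ones. -/
theorem contract_erase (P : Prims) (e : Expr L) :
    contract P e.erase = (contract P e).map Expr.erase := by
  rcases e with _ | _ | _ | ⟨s, a⟩ | ⟨s, a, b⟩ | ⟨s, a, b, c⟩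
  · rfl
  · rfl
  · rfl
  · rcases s with _ | _ | _ | _ <;> rcases a with _ | _ | s | _ | ⟨s, _, _⟩ | _ <;> try rfl
    · rcases s with _ | _ | s | _ | _ | _ | _ | _ | _ | _ <;> try rfl
      simp only [Expr.erase, Sym1.erase, Sym2.erase, contract, Option.map_some]
      split_ifs <;> rfl
    · rcases s with _ | _ | _ | _ | _ <;> try rfl
      simp [Expr.erase, Sym1.erase, contract, Function.comp_def]
  · rcases s with _ | _ | _ | _ | _ | _ | _ | _ | _ | _ <;>
      rcases a with _ | _ | s | _ | _ | _ <;> try rfl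
    · simp [Expr.erase, Sym2.erase, contract, erase_inst]
    · rcases s with (_ | _ | _ | _) | _ | _ | _ | _ <;> rfl
    · rcases s with (_ | _ | _ | _) | _ | _ | _ | _ <;> rfl
    · rcases s with _ | _ | _ | _ | _ <;> try rfl
      rcases b with _ | _ | s | _ | _ | _ <;> try rfl
      rcases s with _ | _ | _ | _ | _ <;> try rfl
      simp [Expr.erase, Sym2.erase, contract, Function.comp_def]
  · rcases s with _ | _ | _ | _ <;> rcases a with _ | _ | s | _ | s | _ <;> try rfl
    · rcases s with _ | _ | _ | _ | _ <;> rfl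
    · rcases s with _ | _ | _ | _ | _ | _ | _ | _ | _ | _ <;> rfl
    · rcases s with (_ | _ | _ | _) | _ | _ | _ | _ <;> rfl

/-! ## One-step reduction as an inductive relation -/

/-- One-step reduction, with one rule for each kind of layer of a context. -/
inductive Red (P : Prims) : Expr L → Expr L → Prop
  | root {e e'} : contract P e = some e' → Red P e e'
  | lam {a a'} : Red P a a' → Red P (.lam a) (.lam a')
  | un {s a a'} : Red P a a' → Red P (.un s a) (.un s a')
  | binL {s a a' b} : Red P a a' → Red P (.bin s a b) (.bin s a' b)
  | binR {s a b b'} : Red P b b' → Red P (.bin s a b) (.bin s a b')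
  | tern1 {s a a' b c} : Red P a a' → Red P (.tern s a b c) (.tern s a' b c)
  | tern2 {s a b b' c} : Red P b b' → Red P (.tern s a b c) (.tern s a b' c)
  | tern3 {s a b c c'} : Red P c c' → Red P (.tern s a b c) (.tern s a b c')

variable {P : Prims}

theorem Red.frame (f : Frame L) {a a' : Expr L} (h : Red P a a') :
    Red P (f.plug a) (f.plug a') := by
  cases f
  · exact .lam h
  · exact .un h
  · exact .binL h
  · exact .binR h
  · exact .tern1 h
  · exact .tern2 h
  · exact .tern3 h

theorem Red.frame_induction {motive : Expr L → Expr L → Prop}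
    (root : ∀ e e', contract P e = some e' → motive e e')
    (frame : ∀ (f : Frame L) a a', Red P a a' → motive a a' → motive (f.plug a) (f.plug a'))
    {e e' : Expr L} (h : Red P e e') : motive e e' := by
  induction h with
  | root h => exact root _ _ h
  | lam h ih => exact frame .lam _ _ h ih
  | un h ih => exact frame (.un _) _ _ h ih
  | binL h ih => exact frame (.binL _ _) _ _ h ih
  | binR h ih => exact frame (.binR _ _) _ _ h ih
  | tern1 h ih => exact frame (.tern1 _ _ _) _ _ h ih
  | tern2 h ih => exact frame (.tern2 _ _ _) _ _ h ih
  | tern3 h ih => exact frame (.tern3 _ _ _) _ _ h ih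

theorem Red.plug (K : Ctx L) {a a' : Expr L} (h : Red P a a') :
    Red P (QIR.plug K a) (QIR.plug K a') := by
  induction K generalizing a a' with
  | nil => exact h
  | cons f K ih => exact ih (h.frame f)

theorem plug_append (K K' : Ctx L) (e : Expr L) : plug (K ++ K') e = plug K' (plug K e) := by
  induction K generalizing e with
  | nil => rfl
  | cons f K ih => exact ih _

theorem step_eq_red : (Step P : Expr L → Expr L → Prop) = Red P := by
  funext e e'
  refine propext ⟨?_, fun h => ?_⟩
  · rintro ⟨K, r, r', rfl, h, rfl⟩
    exact (Red.root h).plug K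
  · refine Red.frame_induction (motive := Step P) (fun e e' h => ⟨[], e, e', rfl, h, rfl⟩) ?_ h
    rintro f _ _ - ⟨K, r, r', rfl, h, rfl⟩
    exact ⟨K ++ [f], r, r', by simp [plug_append, QIR.plug], h, by simp [plug_append, QIR.plug]⟩

theorem Reduces.frame (f : Frame L) {a a' : Expr L} (h : Reduces P a a') :
    Reduces P (f.plug a) (f.plug a') := by
  refine Relation.ReflTransGen.lift f.plug (fun _ _ h => ?_) _ _ h
  rw [step_eq_red] at h ⊢
  exact h.frame f

theorem Red.reduces {a a' : Expr L} (h : Red P a a') : Reduces P a a' :=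
  .single (by rwa [step_eq_red])

theorem Reduces.un {s : Sym1 L} {a a' : Expr L} (h : Reduces P a a') :
    Reduces P (.un s a) (.un s a') := h.frame (.un s)

theorem Reduces.bin {s : Sym2 L} {a a' b b' : Expr L} (h : Reduces P a a')
    (h' : Reduces P b b') : Reduces P (.bin s a b) (.bin s a' b') :=
  (h.frame (.binL s b)).trans (h'.frame (.binR s a'))

theorem Reduces.tern {s : Sym3 L} {a a' b b' c c' : Expr L} (h : Reduces P a a')
    (h' : Reduces P b b') (h'' : Reduces P c c') :
    Reduces P (.tern s a b c) (.tern s a' b' c') :=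
  ((h.frame (.tern1 s b c)).trans (h'.frame (.tern2 s a' c))).trans (h''.frame (.tern3 s a' b'))

/-! ## Reduction and substitution -/

/-- The ways in which an expression can be a redex. -/
theorem contract_cases {motive : ∀ e e' : Expr L, contract P e = some e' → Prop}
    (app : ∀ b a h, motive (.bin .app (.lam b) a) (b.inst a) h)
    (lnil : ∀ n c h, motive (.tern .ldestr (.leaf .lnil) n c) n h)
    (lcons : ∀ x t n c h, motive (.tern .ldestr (.bin .lcons x t) n c)
      (.bin .app (.bin .app c x) t) h)
    (tcons_eq : ∀ s v t h, motive (.un (.tdestr s) (.bin (.tcons s) v t)) v h)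
    (tcons_ne : ∀ s s' v t h, s' ≠ s →
      motive (.un (.tdestr s) (.bin (.tcons s') v t)) (.un (.tdestr s) t) h)
    (ite_true : ∀ a b h, motive (.tern .ite (.leaf (.const (.bool true))) a b) a h)
    (ite_false : ∀ a b h, motive (.tern .ite (.leaf (.const (.bool false))) a b) b h)
    (and_true : ∀ b h, motive (.bin .and (.leaf (.const (.bool true))) b) b h)
    (and_false : ∀ b h, motive (.bin .and (.leaf (.const (.bool false))) b)
      (.leaf (.const (.bool false))) h)
    (or_true : ∀ b h, motive (.bin .or (.leaf (.const (.bool true))) b)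
      (.leaf (.const (.bool true))) h)
    (or_false : ∀ b h, motive (.bin .or (.leaf (.const (.bool false))) b) b h)
    (un_val : ∀ f v w h, P.un f v = some w →
      motive (.un (.val f) (.leaf (.const v))) (.leaf (.const w)) h)
    (bin_val : ∀ f v w u h, P.bin f v w = some u →
      motive (.bin (.val f) (.leaf (.const v)) (.leaf (.const w))) (.leaf (.const u)) h)
    {e e' : Expr L} (h : contract P e = some e') : motive e e' h := by
  have h₀ := h
  unfold contract at h₀
  split at h₀
  · cases h₀; apply app
  · cases h₀; apply lnil
  · cases h₀; apply lcons
  · split_ifs at h₀ with hs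
    · cases h₀; subst hs; apply tcons_eq
    · cases h₀; exact tcons_ne _ _ _ _ _ hs
  · cases h₀; apply ite_true
  · cases h₀; apply ite_false
  · cases h₀; apply and_true
  · cases h₀; apply and_false
  · cases h₀; apply or_true
  · cases h₀; apply or_false
  · obtain ⟨w, hw, rfl⟩ := Option.map_eq_some_iff.1 h₀
    exact un_val _ _ _ _ hw
  · obtain ⟨w, hw, rfl⟩ := Option.map_eq_some_iff.1 h₀
    exact bin_val _ _ _ _ _ hw
  · cases h₀

theorem contract_subst {e e' : Expr L} (h : contract P e = some e') (σ : ℕ → Expr L) :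
    contract P (e.subst σ) = some (e'.subst σ) := by
  induction h using contract_cases <;> simp_all [Expr.subst, contract, inst_subst]

theorem Red.subst {e e' : Expr L} (h : Red P e e') (σ : ℕ → Expr L) :
    Red P (e.subst σ) (e'.subst σ) := by
  induction h generalizing σ with
  | root h => exact .root (contract_subst h σ)
  | lam _ ih => exact .lam (ih _)
  | un _ ih => exact .un (ih _)
  | binL _ ih => exact .binL (ih _)
  | binR _ ih => exact .binR (ih _)
  | tern1 _ ih => exact .tern1 (ih _)
  | tern2 _ ih => exact .tern2 (ih _)
  | tern3 _ ih => exact .tern3 (ih _)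

theorem Red.rename {e e' : Expr L} (h : Red P e e') (r : ℕ → ℕ) :
    Red P (e.rename r) (e'.rename r) := by
  rw [rename_eq_subst, rename_eq_subst]
  exact h.subst _

theorem Reduces.rename {e e' : Expr L} (h : Reduces P e e') (r : ℕ → ℕ) :
    Reduces P (e.rename r) (e'.rename r) := by
  refine Relation.ReflTransGen.lift (Expr.rename r) (fun _ _ h => ?_) _ _ h
  rw [step_eq_red] at h ⊢
  exact h.rename r

/-- Many steps may be needed even when a single `σ n` makes one step, because a variable can have
several occurrences; hence local confluence only, and not the diamond property. -/
theorem reduces_subst (e : Expr L) {σ σ' : ℕ → Expr L} (h : ∀ n, Reduces P (σ n) (σ' n)) :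
    Reduces P (e.subst σ) (e.subst σ') := by
  induction e generalizing σ σ' with
  | var n => exact h n
  | lam b ih =>
    refine (ih fun n => ?_).frame .lam
    cases n with
    | zero => exact .refl
    | succ n => exact (h n).rename _
  | leaf s => exact .refl
  | un s a ih => exact (ih h).un
  | bin s a b iha ihb => exact (iha h).bin (ihb h)
  | tern s a b c iha ihb ihc => exact (iha h).tern (ihb h) (ihc h)

theorem Red.inst_left {b b' : Expr L} (h : Red P b b') (a : Expr L) :
    Red P (b.inst a) (b'.inst a) := by
  rw [inst_eq, inst_eq]
  exact h.subst _

theorem reduces_inst_right (b : Expr L) {a a' : Expr L} (h : Red P a a') :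
    Reduces P (b.inst a) (b.inst a') := by
  rw [inst_eq, inst_eq]
  refine reduces_subst b fun n => ?_
  cases n with
  | zero => exact h.reduces
  | succ n => exact .refl

/-! ## Confluence -/

theorem not_red_leaf {s : Sym0} {e : Expr L} : ¬ Red P (.leaf s) e := by
  intro h
  cases h with
  | root h => simp [contract] at h

/-- The constructors matched by a rule cannot themselves be reduced at their root, so the second
step takes place inside an argument of the rule. The redex survives it, and the argument is kept,
erased or copied by the contraction. -/
theorem contract_red_join {e a b : Expr L} (h : contract P e = some a) (h' : Red P e b) :
    ∃ d, Reduces P a d ∧ Reduces P b d := by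
  induction h using contract_cases with
  | app b a h₀ =>
    cases h' with
    | root h => cases h; exact ⟨_, .refl, .refl⟩
    | binL h =>
      cases h with
      | root h => cases h
      | lam h => exact ⟨_, (h.inst_left a).reduces, (Red.root rfl).reduces⟩
    | binR h => exact ⟨_, reduces_inst_right b h, (Red.root rfl).reduces⟩
  | lnil n c h₀ =>
    cases h' with
    | root h => cases h; exact ⟨_, .refl, .refl⟩
    | tern1 h => exact (not_red_leaf h).elim
    | tern2 h => exact ⟨_, h.reduces, (Red.root rfl).reduces⟩
    | tern3 h => exact ⟨_, .refl, (Red.root rfl).reduces⟩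
  | lcons x t n c h₀ =>
    cases h' with
    | root h => cases h; exact ⟨_, .refl, .refl⟩
    | tern1 h =>
      cases h with
      | root h => cases h
      | binL h => exact ⟨_, (h.binR.binL).reduces, (Red.root rfl).reduces⟩
      | binR h => exact ⟨_, h.binR.reduces, (Red.root rfl).reduces⟩
    | tern2 h => exact ⟨_, .refl, (Red.root rfl).reduces⟩
    | tern3 h => exact ⟨_, h.binL.binL.reduces, (Red.root rfl).reduces⟩
  | tcons_eq s v t h₀ =>
    have key (v' t' : Expr L) :
        Red P (.un (.tdestr s) (.bin (.tcons s) v' t')) v' := .root (by simp [contract])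
    cases h' with
    | root h => simp [contract] at h; subst h; exact ⟨_, .refl, .refl⟩
    | un h =>
      cases h with
      | root h => cases h
      | binL h => exact ⟨_, h.reduces, (key _ _).reduces⟩
      | binR h => exact ⟨_, .refl, (key _ _).reduces⟩
  | tcons_ne s s' v t h₀ hs =>
    have key (v' t' : Expr L) : Red P (.un (.tdestr s) (.bin (.tcons s') v' t'))
        (.un (.tdestr s) t') := .root (by simp [contract, hs])
    cases h' with
    | root h => simp [contract, hs] at h; subst h; exact ⟨_, .refl, .refl⟩
    | un h =>
      cases h with
      | root h => cases h
      | binL h => exact ⟨_, .refl, (key _ _).reduces⟩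
      | binR h => exact ⟨_, h.un.reduces, (key _ _).reduces⟩
  | ite_true a b h₀ =>
    cases h' with
    | root h => cases h; exact ⟨_, .refl, .refl⟩
    | tern1 h => exact (not_red_leaf h).elim
    | tern2 h => exact ⟨_, h.reduces, (Red.root rfl).reduces⟩
    | tern3 h => exact ⟨_, .refl, (Red.root rfl).reduces⟩
  | ite_false a b h₀ =>
    cases h' with
    | root h => cases h; exact ⟨_, .refl, .refl⟩
    | tern1 h => exact (not_red_leaf h).elim
    | tern2 h => exact ⟨_, .refl, (Red.root rfl).reduces⟩
    | tern3 h => exact ⟨_, h.reduces, (Red.root rfl).reduces⟩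
  | and_true b h₀ =>
    cases h' with
    | root h => cases h; exact ⟨_, .refl, .refl⟩
    | binL h => exact (not_red_leaf h).elim
    | binR h => exact ⟨_, h.reduces, (Red.root rfl).reduces⟩
  | and_false b h₀ =>
    cases h' with
    | root h => cases h; exact ⟨_, .refl, .refl⟩
    | binL h => exact (not_red_leaf h).elim
    | binR h => exact ⟨_, .refl, (Red.root rfl).reduces⟩
  | or_true b h₀ =>
    cases h' with
    | root h => cases h; exact ⟨_, .refl, .refl⟩
    | binL h => exact (not_red_leaf h).elim
    | binR h => exact ⟨_, .refl, (Red.root rfl).reduces⟩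
  | or_false b h₀ =>
    cases h' with
    | root h => cases h; exact ⟨_, .refl, .refl⟩
    | binL h => exact (not_red_leaf h).elim
    | binR h => exact ⟨_, h.reduces, (Red.root rfl).reduces⟩
  | un_val f v w h₀ hw =>
    cases h' with
    | root h => simp [contract, hw] at h; subst h; exact ⟨_, .refl, .refl⟩
    | un h => exact (not_red_leaf h).elim
  | bin_val f v w u h₀ hu =>
    cases h' with
    | root h => simp [contract, hu] at h; subst h; exact ⟨_, .refl, .refl⟩
    | binL h => exact (not_red_leaf h).elim
    | binR h => exact (not_red_leaf h).elim

/-- Steps in different arguments commute, steps in the same argument are joined by induction, and a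
step at the root is the case of `contract_red_join`. -/
theorem red_locally_confluent {e a b : Expr L} (h : Red P e a) (h' : Red P e b) :
    ∃ d, Reduces P a d ∧ Reduces P b d := by
  have swap {a b : Expr L} : (∃ d, Reduces P a d ∧ Reduces P b d) →
      ∃ d, Reduces P b d ∧ Reduces P a d := fun ⟨d, h, h'⟩ => ⟨d, h', h⟩
  induction h generalizing b with
  | root h => exact contract_red_join h h'
  | lam h ih =>
    cases h' with
    | root h' => cases h'
    | lam h' => obtain ⟨d, h₁, h₂⟩ := ih h'; exact ⟨_, h₁.frame .lam, h₂.frame .lam⟩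
  | un h ih =>
    cases h' with
    | root h' => exact swap (contract_red_join h' h.un)
    | un h' => obtain ⟨d, h₁, h₂⟩ := ih h'; exact ⟨_, h₁.un, h₂.un⟩
  | binL h ih =>
    cases h' with
    | root h' => exact swap (contract_red_join h' h.binL)
    | binL h' => obtain ⟨d, h₁, h₂⟩ := ih h'; exact ⟨_, h₁.bin .refl, h₂.bin .refl⟩
    | binR h' => exact ⟨_, h'.binR.reduces, h.binL.reduces⟩
  | binR h ih =>
    cases h' with
    | root h' => exact swap (contract_red_join h' h.binR)
    | binL h' => exact ⟨_, h'.binL.reduces, h.binR.reduces⟩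
    | binR h' =>
      obtain ⟨d, h₁, h₂⟩ := ih h'
      exact ⟨_, Reduces.bin .refl h₁, Reduces.bin .refl h₂⟩
  | tern1 h ih =>
    cases h' with
    | root h' => exact swap (contract_red_join h' h.tern1)
    | tern1 h' => obtain ⟨d, h₁, h₂⟩ := ih h'; exact ⟨_, h₁.tern .refl .refl, h₂.tern .refl .refl⟩
    | tern2 h' => exact ⟨_, h'.tern2.reduces, h.tern1.reduces⟩
    | tern3 h' => exact ⟨_, h'.tern3.reduces, h.tern1.reduces⟩
  | tern2 h ih =>
    cases h' with
    | root h' => exact swap (contract_red_join h' h.tern2)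
    | tern1 h' => exact ⟨_, h'.tern1.reduces, h.tern2.reduces⟩
    | tern2 h' =>
      obtain ⟨d, h₁, h₂⟩ := ih h'
      exact ⟨_, Reduces.tern .refl h₁ .refl, Reduces.tern .refl h₂ .refl⟩
    | tern3 h' => exact ⟨_, h'.tern3.reduces, h.tern2.reduces⟩
  | tern3 h ih =>
    cases h' with
    | root h' => exact swap (contract_red_join h' h.tern3)
    | tern1 h' => exact ⟨_, h'.tern1.reduces, h.tern3.reduces⟩
    | tern2 h' => exact ⟨_, h'.tern2.reduces, h.tern3.reduces⟩
    | tern3 h' =>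
      obtain ⟨d, h₁, h₂⟩ := ih h'
      exact ⟨_, Reduces.tern .refl .refl h₁, Reduces.tern .refl .refl h₂⟩

/-- Newman's lemma. -/
theorem join_of_acc {α : Type*} {r : α → α → Prop}
    (hr : ∀ a b c, r a b → r a c →
      ∃ d, Relation.ReflTransGen r b d ∧ Relation.ReflTransGen r c d)
    {a : α} (ha : Acc (fun x y => r y x) a) {b c : α} (hb : Relation.ReflTransGen r a b)
    (hc : Relation.ReflTransGen r a c) :
    ∃ d, Relation.ReflTransGen r b d ∧ Relation.ReflTransGen r c d := by
  induction ha generalizing b c with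
  | intro a _ ih =>
    rcases hb.cases_head with rfl | ⟨b₁, hab, hb⟩
    · exact ⟨c, hc, .refl⟩
    rcases hc.cases_head with rfl | ⟨c₁, hac, hc⟩
    · exact ⟨b, .refl, .head hab hb⟩
    obtain ⟨d, hbd, hcd⟩ := hr a b₁ c₁ hab hac
    obtain ⟨d₁, h₁, h₂⟩ := ih b₁ hab hb hbd
    obtain ⟨d₂, h₃, h₄⟩ := ih c₁ hac (hcd.trans h₂) hc
    exact ⟨d₂, h₁.trans h₃, h₄⟩

theorem reduces_join {e a b : Expr L} (he : Acc (fun a b => Step P b a) e) (ha : Reduces P e a)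
    (hb : Reduces P e b) : ∃ d, Reduces P a d ∧ Reduces P b d :=
  join_of_acc (fun _ _ _ h h' => by
    rw [step_eq_red] at h h'
    exact red_locally_confluent h h') he ha hb

/-! ## Reduction and erasure of identifiers -/

theorem Red.erase {f f' : Expr L} (h : Red P f f') : Red P f.erase f'.erase := by
  induction h with
  | root h => exact .root (by rw [contract_erase, h]; rfl)
  | lam _ ih => exact .lam ih
  | un _ ih => exact .un ih
  | binL _ ih => exact .binL ih
  | binR _ ih => exact .binR ih
  | tern1 _ ih => exact .tern1 ih
  | tern2 _ ih => exact .tern2 ih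
  | tern3 _ ih => exact .tern3 ih

theorem Reduces.erase {f f' : Expr L} (h : Reduces P f f') : Reduces P f.erase f'.erase := by
  refine Relation.ReflTransGen.lift Expr.erase (fun _ _ h => ?_) _ _ h
  rw [step_eq_red] at h ⊢
  exact h.erase

theorem Red.lift {f : Expr L} {e' : Expr Unit} (h : Red P f.erase e') :
    ∃ f', Red P f f' ∧ f'.erase = e' := by
  have root {f : Expr L} {e' : Expr Unit} (h : contract P f.erase = some e') :
      ∃ f', Red P f f' ∧ f'.erase = e' := by
    rw [contract_erase] at h
    obtain ⟨f', h₁, rfl⟩ := Option.map_eq_some_iff.1 h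
    exact ⟨f', .root h₁, rfl⟩
  induction f generalizing e' with
  | var n => cases h with | root h => cases h
  | leaf s => cases h with | root h => cases h
  | lam b ih =>
    cases h with
    | root h => cases h
    | lam h => obtain ⟨_, h₁, rfl⟩ := ih h; exact ⟨_, h₁.lam, rfl⟩
  | un s a ih =>
    cases h with
    | root h => exact root h
    | un h => obtain ⟨_, h₁, rfl⟩ := ih h; exact ⟨_, h₁.un, rfl⟩
  | bin s a b iha ihb =>
    cases h with
    | root h => exact root h
    | binL h => obtain ⟨_, h₁, rfl⟩ := iha h; exact ⟨_, h₁.binL, rfl⟩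
    | binR h => obtain ⟨_, h₁, rfl⟩ := ihb h; exact ⟨_, h₁.binR, rfl⟩
  | tern s a b c iha ihb ihc =>
    cases h with
    | root h => exact root h
    | tern1 h => obtain ⟨_, h₁, rfl⟩ := iha h; exact ⟨_, h₁.tern1, rfl⟩
    | tern2 h => obtain ⟨_, h₁, rfl⟩ := ihb h; exact ⟨_, h₁.tern2, rfl⟩
    | tern3 h => obtain ⟨_, h₁, rfl⟩ := ihc h; exact ⟨_, h₁.tern3, rfl⟩

theorem Reduces.lift {f : Expr L} {e' : Expr Unit} (h : Reduces P f.erase e') :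
    ∃ f', Reduces P f f' ∧ f'.erase = e' := by
  induction h with
  | refl => exact ⟨f, .refl, rfl⟩
  | tail _ h ih =>
    obtain ⟨f₁, h₁, rfl⟩ := ih
    rw [step_eq_red] at h
    obtain ⟨f₂, h₂, rfl⟩ := h.lift
    exact ⟨f₂, h₁.trans h₂.reduces, rfl⟩

theorem acc_of_stronglyNormalizing {f : Expr L} (h : StronglyNormalizing P f.erase) :
    Acc (fun a b => Step P b a) f := by
  refine Subrelation.accessible ?_ (InvImage.accessible Expr.erase h)
  intro a b hab
  show Step P b.erase a.erase
  rw [step_eq_red] at hab ⊢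
  exact hab.erase

end

section

variable {L : Type} {P : Prims}

/-! ## Stuck expressions -/

/-- The constructs that may become redexes: `tdestr` and the primitive functions. -/
def Sym1.Strict : Sym1 L → Prop
  | .tdestr _ => True
  | .val _ => True
  | _ => False

/-- The constructs that may become redexes: applications, connectives, primitive functions. -/
def Sym2.Strict : Sym2 L → Prop
  | .app => True
  | .and => True
  | .or => True
  | .val _ => True
  | _ => False

/-- The constructs that may become redexes: `ldestr` and conditionals. -/
def Sym3.Strict : Sym3 L → Prop
  | .ldestr => True
  | .ite => True
  | _ => False

/-- The root symbol of an expression, represented by an expression with trivial arguments. -/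
def root : Expr L → Expr L
  | .var _ => .var 0
  | .lam _ => .lam (.var 0)
  | .leaf s => .leaf s
  | .un s _ => .un s (.var 0)
  | .bin s _ _ => .bin s (.var 0) (.var 0)
  | .tern s _ _ _ => .tern s (.var 0) (.var 0) (.var 0)

/-- `HeadStuck P Γ e`: the root symbol of `e` can never change, provided that the variables in `Γ`
are never replaced. -/
def HeadStuck (P : Prims) (Γ : ℕ → Prop) : Expr L → Prop
  | .var n => Γ n
  | .lam _ => True
  | .leaf _ => True
  | .un s a => s.Strict → contract P (.un s a) = none ∧ HeadStuck P Γ a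
  | .bin s a b => s.Strict → contract P (.bin s a b) = none ∧ HeadStuck P Γ a ∧
      (∀ f v, s = .val f → a = .leaf (.const v) → HeadStuck P Γ b)
  | .tern s a b c => s.Strict → contract P (.tern s a b c) = none ∧ HeadStuck P Γ a

theorem root_eq_lam {a b : Expr L} (h : root a = root (.lam b)) : ∃ b', a = .lam b' := by
  cases a <;> simp [root] at h ⊢

theorem root_eq_leaf {a : Expr L} {s} (h : root a = root (.leaf s)) : a = .leaf s := by
  cases a <;> simp [root] at h ⊢; exact h

theorem root_eq_bin {a b c : Expr L} {s} (h : root a = root (.bin s b c)) :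
    ∃ b' c', a = .bin s b' c' := by
  cases a <;> simp [root] at h ⊢; exact h

/-- Whether an expression is a redex depends only on its symbol and on the root symbol of its first
argument, and also on that of the second argument for a binary primitive function whose first
argument is a constant. -/
theorem contract_un_congr {s : Sym1 L} {a a' : Expr L} (h : root a = root a')
    (hc : contract P (.un s a) = none) : contract P (.un s a') = none := by
  rw [Option.eq_none_iff_forall_ne_some] at hc ⊢
  intro r hr
  generalize he : Expr.un s a' = e at hr
  induction hr using contract_cases <;> cases he
  · obtain ⟨_, _, rfl⟩ := root_eq_bin h; exact hc _ (by simp [contract]; rfl)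
  · obtain ⟨_, _, rfl⟩ := root_eq_bin h; exact hc _ (by simp [contract]; rfl)
  · rw [root_eq_leaf h] at hc
    exact hc _ ‹_›

theorem contract_bin_congr {s : Sym2 L} {a a' b b' : Expr L} (h : root a = root a')
    (h' : ∀ f v, s = .val f → a = .leaf (.const v) → root b = root b')
    (hc : contract P (.bin s a b) = none) : contract P (.bin s a' b') = none := by
  rw [Option.eq_none_iff_forall_ne_some] at hc ⊢
  intro r hr
  generalize he : Expr.bin s a' b' = e at hr
  induction hr using contract_cases <;> cases he
  · obtain ⟨_, rfl⟩ := root_eq_lam h; exact hc _ rfl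
  · rw [root_eq_leaf h] at hc; exact hc _ rfl
  · rw [root_eq_leaf h] at hc; exact hc _ rfl
  · rw [root_eq_leaf h] at hc; exact hc _ rfl
  · rw [root_eq_leaf h] at hc; exact hc _ rfl
  · rw [root_eq_leaf (h' _ _ rfl (root_eq_leaf h)), root_eq_leaf h] at hc
    exact hc _ ‹_›

theorem contract_tern_congr {s : Sym3 L} {a a' b b' c c' : Expr L} (h : root a = root a')
    (hc : contract P (.tern s a b c) = none) : contract P (.tern s a' b' c') = none := by
  rw [Option.eq_none_iff_forall_ne_some] at hc ⊢
  intro r hr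
  generalize he : Expr.tern s a' b' c' = e at hr
  induction hr using contract_cases <;> cases he
  · rw [root_eq_leaf h] at hc; exact hc _ rfl
  · obtain ⟨_, _, rfl⟩ := root_eq_bin h; exact hc _ rfl
  · rw [root_eq_leaf h] at hc; exact hc _ rfl
  · rw [root_eq_leaf h] at hc; exact hc _ rfl

/-- Consequently a lambda directly in a redex is never at a stuck place, and the variable replaced
by a contraction is never a stuck one. -/
theorem not_headStuck_of_contract {e e' : Expr L} (Γ : ℕ → Prop) (h : contract P e = some e') :
    ¬ HeadStuck P Γ e := by
  induction h using contract_cases <;>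
    simp_all [HeadStuck, Sym1.Strict, Sym2.Strict, Sym3.Strict]

/-- Stuck expressions remain stuck under reduction, with the same root symbol. -/
theorem HeadStuck.red {Γ : ℕ → Prop} {e e' : Expr L} (h : Red P e e') (he : HeadStuck P Γ e) :
    HeadStuck P Γ e' ∧ root e' = root e := by
  induction h with
  | root h => exact (not_headStuck_of_contract Γ h he).elim
  | lam _ _ => exact ⟨trivial, rfl⟩
  | un _ ih =>
    refine ⟨fun hs => ?_, rfl⟩
    obtain ⟨h₁, h₂⟩ := he hs
    obtain ⟨h₃, h₄⟩ := ih h₂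
    exact ⟨contract_un_congr h₄.symm h₁, h₃⟩
  | @binL s a a' b h ih =>
    refine ⟨fun hs => ?_, rfl⟩
    obtain ⟨h₁, h₂, h₃⟩ := he hs
    obtain ⟨h₄, h₅⟩ := ih h₂
    refine ⟨contract_bin_congr h₅.symm (fun _ _ _ _ => rfl) h₁, h₄, fun f v hs ha => ?_⟩
    subst ha
    exact h₃ f v hs (root_eq_leaf h₅.symm)
  | binR _ ih =>
    refine ⟨fun hs => ?_, rfl⟩
    obtain ⟨h₁, h₂, h₃⟩ := he hs
    exact ⟨contract_bin_congr rfl (fun f v hs ha => (ih (h₃ f v hs ha)).2.symm) h₁, h₂,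
      fun f v hs ha => (ih (h₃ f v hs ha)).1⟩
  | tern1 _ ih =>
    refine ⟨fun hs => ?_, rfl⟩
    obtain ⟨h₁, h₂⟩ := he hs
    obtain ⟨h₃, h₄⟩ := ih h₂
    exact ⟨contract_tern_congr h₄.symm h₁, h₃⟩
  | tern2 _ _ => exact ⟨fun hs => ⟨contract_tern_congr rfl (he hs).1, (he hs).2⟩, rfl⟩
  | tern3 _ _ => exact ⟨fun hs => ⟨contract_tern_congr rfl (he hs).1, (he hs).2⟩, rfl⟩

/-- The substitution `σ` maps the variables in `Γ` to variables in `Γ'`, with left inverse `τ`. -/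
def Respects (Γ Γ' : ℕ → Prop) (σ : ℕ → Expr L) (τ : ℕ → ℕ) : Prop :=
  ∀ n, Γ n → ∃ m, σ n = .var m ∧ Γ' m ∧ τ m = n

/-- Stuck expressions remain stuck under the substitutions that rename the stuck variables, with the
same root symbol. -/
theorem HeadStuck.subst {Γ Γ' : ℕ → Prop} {σ : ℕ → Expr L} {τ : ℕ → ℕ}
    (hσ : Respects Γ Γ' σ τ) {e : Expr L} (he : HeadStuck P Γ e) :
    HeadStuck P Γ' (e.subst σ) ∧ root (e.subst σ) = root e := by
  induction e with
  | var n =>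
    obtain ⟨m, h, hm, -⟩ := hσ n he
    simp only [Expr.subst, h]
    exact ⟨hm, rfl⟩
  | lam _ => exact ⟨trivial, rfl⟩
  | leaf _ => exact ⟨trivial, rfl⟩
  | un s a ih =>
    refine ⟨fun hs => ?_, rfl⟩
    obtain ⟨h₁, h₂⟩ := he hs
    obtain ⟨h₃, h₄⟩ := ih h₂
    exact ⟨contract_un_congr h₄.symm h₁, h₃⟩
  | bin s a b iha ihb =>
    refine ⟨fun hs => ?_, rfl⟩
    obtain ⟨h₁, h₂, h₃⟩ := he hs
    obtain ⟨h₄, h₅⟩ := iha h₂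
    refine ⟨contract_bin_congr h₅.symm (fun f v hs ha => (ihb (h₃ f v hs ha)).2.symm) h₁, h₄,
      fun f v hs ha => (ihb (h₃ f v hs (root_eq_leaf ?_))).1⟩
    rw [← h₅, ha]
  | tern s a b c iha _ _ =>
    refine ⟨fun hs => ?_, rfl⟩
    obtain ⟨h₁, h₂⟩ := he hs
    obtain ⟨h₃, h₄⟩ := iha h₂
    exact ⟨contract_tern_congr h₄.symm h₁, h₃⟩

theorem opInfo_root (e : Expr L) : (root e).opInfo = e.opInfo := by
  rcases e with _ | _ | _ | ⟨s, _⟩ | ⟨s, _, _⟩ | ⟨s, _, _, _⟩ <;> try rfl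
  all_goals cases s <;> rfl

/-! ## Stuck variables and stuck positions -/

/-- Extension of a predicate on indices under a binder. -/
def upPred (p : Prop) (Γ : ℕ → Prop) : ℕ → Prop
  | 0 => p
  | n + 1 => Γ n

/-- Whether a lambda that is an immediate subexpression of `e` is stuck, where the variables in `Γ`
are stuck, and `pos` tells whether a lambda in the place of `e` is stuck. -/
def childPos (P : Prims) (Γ : ℕ → Prop) (pos : Prop) : Expr L → Prop
  | .lam _ => pos
  | .bin .lcons _ _ => pos
  | .bin (.tcons _) _ _ => pos
  | e => HeadStuck P Γ e

theorem Respects.up {Γ Γ' : ℕ → Prop} {σ : ℕ → Expr L} {τ : ℕ → ℕ} (hσ : Respects Γ Γ' σ τ)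
    {p p' : Prop} (hp : p → p') :
    Respects (upPred p Γ) (upPred p' Γ') (upSubst σ) (upRen τ) := by
  intro n hn
  cases n with
  | zero => exact ⟨0, rfl, hp hn, rfl⟩
  | succ n =>
    obtain ⟨m, h, hm, hτ⟩ := hσ n hn
    exact ⟨m + 1, by simp [upSubst, h, Expr.rename], hm, by simp [upRen, hτ]⟩

theorem Respects.of_le {Γ Γ' : ℕ → Prop} (h : ∀ n, Γ n → Γ' n) :
    Respects Γ Γ' (.var : ℕ → Expr L) id :=
  fun n hn => ⟨n, rfl, h n hn, rfl⟩

theorem childPos_subst {Γ Γ' : ℕ → Prop} {σ : ℕ → Expr L} {τ : ℕ → ℕ}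
    (hσ : Respects Γ Γ' σ τ) {pos pos' : Prop} (hp : pos → pos') {e : Expr L}
    (he : childPos P Γ pos e) : childPos P Γ' pos' (e.subst σ) := by
  have key (h : HeadStuck P Γ e) := (h.subst hσ).1
  rcases e with n | _ | _ | _ | ⟨s, _, _⟩ | _
  · obtain ⟨m, h, hm, -⟩ := hσ n he
    simpa only [Expr.subst, h]
  · exact hp he
  · exact trivial
  · exact key he
  · cases s <;> first | exact hp he | exact key he
  · exact key he

theorem childPos_red {Γ : ℕ → Prop} {pos : Prop} (f : Frame L) {a a' : Expr L}
    (h : Red P a a') (he : childPos P Γ pos (f.plug a)) : childPos P Γ pos (f.plug a') := by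
  have key (hs : HeadStuck P Γ (f.plug a)) := (hs.red (h.frame f)).1
  rcases f with _ | _ | ⟨s, _⟩ | ⟨s, _⟩ | _ | _ | _
  · exact he
  · exact key he
  · cases s <;> first | exact he | exact key he
  · cases s <;> first | exact he | exact key he
  · exact key he
  · exact key he
  · exact key he

/-- The immediate subexpressions. -/
def subs : Expr L → List (Expr L)
  | .var _ => []
  | .lam b => [b]
  | .leaf _ => []
  | .un _ a => [a]
  | .bin _ a b => [a, b]
  | .tern _ a b c => [a, b, c]

/-- If `e` is an operator with identifier `i`, then it is of kind `k`, and its immediate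
subexpression number `j` satisfies `q`. -/
def OpSub (i : L) (k : OpKind) (j : ℕ) (q : Expr L → Prop) (e : Expr L) : Prop :=
  ∀ k', e.opInfo = some (k', i) → k' = k ∧ ∀ c, (subs e)[j]? = some c → q c

/-- Every subexpression `o` of `e` satisfies `OpSub i k j (q Γ') o`, where `Γ'` is the set of the
stuck variables at `o`. -/
def AllOpSub (P : Prims) (i : L) (k : OpKind) (j : ℕ) (q : (ℕ → Prop) → Expr L → Prop) :
    (ℕ → Prop) → Prop → Expr L → Prop
  | _, _, .var _ => True
  | Γ, pos, .lam b => AllOpSub P i k j q (upPred pos Γ) pos b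
  | _, _, .leaf _ => True
  | Γ, pos, .un s a => OpSub i k j (q Γ) (.un s a) ∧
      AllOpSub P i k j q Γ (childPos P Γ pos (.un s a)) a
  | Γ, pos, .bin s a b => OpSub i k j (q Γ) (.bin s a b) ∧
      AllOpSub P i k j q Γ (childPos P Γ pos (.bin s a b)) a ∧
      AllOpSub P i k j q Γ (childPos P Γ pos (.bin s a b)) b
  | Γ, pos, .tern s a b c => OpSub i k j (q Γ) (.tern s a b c) ∧
      AllOpSub P i k j q Γ (childPos P Γ pos (.tern s a b c)) a ∧
      AllOpSub P i k j q Γ (childPos P Γ pos (.tern s a b c)) b ∧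
      AllOpSub P i k j q Γ (childPos P Γ pos (.tern s a b c)) c

/-- Properties of the subexpressions of stuck places that are preserved by reduction. -/
structure Persistent (P : Prims) (q : (ℕ → Prop) → Expr L → Prop) : Prop where
  subst : ∀ {Γ Γ' σ τ} {c : Expr L}, Respects Γ Γ' σ τ → q Γ c → q Γ' (c.subst σ)
  red : ∀ {Γ} {c c' : Expr L}, Red P c c' → q Γ c → q Γ c'

variable {i : L} {k : OpKind} {j : ℕ} {q : (ℕ → Prop) → Expr L → Prop}

theorem subs_subst {e : Expr L} (he : e.opInfo ≠ none) (σ : ℕ → Expr L) :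
    subs (e.subst σ) = (subs e).map (Expr.subst σ) := by
  cases e <;> first | rfl | exact (he rfl).elim

theorem opInfo_un (s : Sym1 L) (a a' : Expr L) :
    (Expr.un s a).opInfo = (Expr.un s a').opInfo := by
  cases s <;> rfl

theorem opInfo_bin (s : Sym2 L) (a b a' b' : Expr L) :
    (Expr.bin s a b).opInfo = (Expr.bin s a' b').opInfo := by
  cases s <;> rfl

theorem opInfo_tern (s : Sym3 L) (a b c a' b' c' : Expr L) :
    (Expr.tern s a b c).opInfo = (Expr.tern s a' b' c').opInfo := by
  cases s <;> rfl

theorem opInfo_subst {e : Expr L} (he : e.opInfo ≠ none) (σ : ℕ → Expr L) :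
    (e.subst σ).opInfo = e.opInfo := by
  cases e
  · exact (he rfl).elim
  · rfl
  · rfl
  · exact opInfo_un _ _ _
  · exact opInfo_bin _ _ _ _ _
  · exact opInfo_tern _ _ _ _ _ _ _

theorem opInfo_plug (f : Frame L) (a a' : Expr L) : (f.plug a).opInfo = (f.plug a').opInfo := by
  cases f
  · rfl
  · exact opInfo_un _ _ _
  · exact opInfo_bin _ _ _ _ _
  · exact opInfo_bin _ _ _ _ _
  · exact opInfo_tern _ _ _ _ _ _ _
  · exact opInfo_tern _ _ _ _ _ _ _
  · exact opInfo_tern _ _ _ _ _ _ _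

theorem subs_plug (f : Frame L) : ∃ l l', ∀ a, subs (f.plug a) = l ++ a :: l' := by
  rcases f with _ | _ | ⟨_, b⟩ | ⟨_, a⟩ | ⟨_, b, c⟩ | ⟨_, a, c⟩ | ⟨_, a, b⟩
  · exact ⟨[], [], fun _ => rfl⟩
  · exact ⟨[], [], fun _ => rfl⟩
  · exact ⟨[], [b], fun _ => rfl⟩
  · exact ⟨[a], [], fun _ => rfl⟩
  · exact ⟨[], [b, c], fun _ => rfl⟩
  · exact ⟨[a], [c], fun _ => rfl⟩
  · exact ⟨[a, b], [], fun _ => rfl⟩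

theorem OpSub.subst (hq : Persistent P q) {Γ Γ' σ τ} (hσ : Respects Γ Γ' σ τ) {e : Expr L}
    (hne : ∀ n, e ≠ .var n) (he : OpSub i k j (q Γ) e) : OpSub i k j (q Γ') (e.subst σ) := by
  intro k' hk
  have hi : e.opInfo ≠ none := by
    intro h
    rcases e with n | _ | _ | _ | _ | _
    · exact hne n rfl
    · cases hk
    · cases hk
    all_goals
      simp only [Expr.subst] at hk
      first
        | rw [opInfo_un, h] at hk
        | rw [opInfo_bin, h] at hk
        | rw [opInfo_tern, h] at hk
      cases hk
  rw [opInfo_subst hi] at hk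
  refine ⟨(he k' hk).1, fun c hc => ?_⟩
  rw [subs_subst hi, List.getElem?_map] at hc
  obtain ⟨c, hc', rfl⟩ := Option.map_eq_some_iff.1 hc
  exact hq.subst hσ ((he k' hk).2 c hc')

theorem OpSub.red (hq : Persistent P q) {Γ} (f : Frame L) {a a' : Expr L} (h : Red P a a')
    (he : OpSub i k j (q Γ) (f.plug a)) : OpSub i k j (q Γ) (f.plug a') := by
  intro k' hk
  rw [opInfo_plug f a' a] at hk
  obtain ⟨hk, hs⟩ := he k' hk
  refine ⟨hk, fun c hc => ?_⟩
  obtain ⟨l, l', hl⟩ := subs_plug f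
  rw [hl] at hc hs
  rw [List.getElem?_append] at hc hs
  split_ifs at hc hs with hj
  · exact hs c hc
  · rcases hjl : j - l.length with _ | m
    · rw [hjl] at hc hs
      cases hc
      exact hq.red h (hs a rfl)
    · rw [hjl] at hc hs
      exact hs c hc

theorem AllOpSub.rename (hq : Persistent P q) {Γ Γ' r τ} {pos pos' : Prop} {e : Expr L}
    (hr : Respects Γ Γ' (fun n => (.var (r n) : Expr L)) τ) (hp : pos → pos')
    (he : AllOpSub P i k j q Γ pos e) : AllOpSub P i k j q Γ' pos' (e.rename r) := by
  induction e generalizing Γ Γ' r τ pos pos' with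
  | var n => trivial
  | lam b ih =>
    refine ih (τ := upRen τ) ?_ hp he
    rw [← upSubst_var]
    exact hr.up hp
  | leaf s => trivial
  | un s a ih =>
    have h₁ := OpSub.subst hq hr (by simp) he.1
    have h₂ := childPos_subst (P := P) hr hp (e := .un s a)
    rw [← rename_eq_subst] at h₁ h₂
    exact ⟨h₁, ih hr h₂ he.2⟩
  | bin s a b iha ihb =>
    have h₁ := OpSub.subst hq hr (by simp) he.1
    have h₂ := childPos_subst (P := P) hr hp (e := .bin s a b)
    rw [← rename_eq_subst] at h₁ h₂
    exact ⟨h₁, iha hr h₂ he.2.1, ihb hr h₂ he.2.2⟩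
  | tern s a b c iha ihb ihc =>
    have h₁ := OpSub.subst hq hr (by simp) he.1
    have h₂ := childPos_subst (P := P) hr hp (e := .tern s a b c)
    rw [← rename_eq_subst] at h₁ h₂
    exact ⟨h₁, iha hr h₂ he.2.1, ihb hr h₂ he.2.2.1, ihc hr h₂ he.2.2.2⟩

/-- Enlarging the set of stuck variables is the special case of the identity renaming. -/
theorem AllOpSub.mono (hq : Persistent P q) {Γ Γ' : ℕ → Prop} {pos pos' : Prop} {e : Expr L}
    (hΓ : ∀ n, Γ n → Γ' n) (hp : pos → pos') (he : AllOpSub P i k j q Γ pos e) :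
    AllOpSub P i k j q Γ' pos' e := by
  have := AllOpSub.rename hq (r := id) (Respects.of_le hΓ) hp he
  rwa [rename_id] at this

/-- The copies of `σ n` can land at any place, stuck or not. They are therefore required to satisfy
the invariant with the weakest assumption on their place, `False`, from which monotonicity gives all
others. -/
theorem AllOpSub.subst (hq : Persistent P q) {Γ Γ' σ τ} {pos pos' : Prop} {e : Expr L}
    (hσ : Respects Γ Γ' σ τ) (hp : pos → pos') (hn : ∀ n, AllOpSub P i k j q Γ' False (σ n))
    (he : AllOpSub P i k j q Γ pos e) : AllOpSub P i k j q Γ' pos' (e.subst σ) := by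
  induction e generalizing Γ Γ' σ τ pos pos' with
  | var n => exact (hn n).mono hq (fun _ => id) False.elim
  | lam b ih =>
    refine ih (hσ.up hp) hp (fun n => ?_) he
    cases n with
    | zero => trivial
    | succ n => exact (hn n).rename hq (τ := Nat.pred) (fun m hm => ⟨_, rfl, hm, rfl⟩) id
  | leaf s => trivial
  | un s a ih =>
    exact ⟨OpSub.subst hq hσ (by simp) he.1,
      ih hσ (childPos_subst hσ hp (e := .un s a)) hn he.2⟩
  | bin s a b iha ihb =>
    have h := childPos_subst (P := P) hσ hp (e := .bin s a b)
    exact ⟨OpSub.subst hq hσ (by simp) he.1, iha hσ h hn he.2.1, ihb hσ h hn he.2.2⟩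
  | tern s a b c iha ihb ihc =>
    have h := childPos_subst (P := P) hσ hp (e := .tern s a b c)
    exact ⟨OpSub.subst hq hσ (by simp) he.1, iha hσ h hn he.2.1, ihb hσ h hn he.2.2.1,
      ihc hσ h hn he.2.2.2⟩

theorem OpSub.of_none {q : Expr L → Prop} {e : Expr L} (h : e.opInfo = none) :
    OpSub i k j q e := by
  intro k' hk
  rw [h] at hk
  cases hk

/-- A redex is not stuck, so its arguments satisfy the invariant at a place that is not stuck and,
by monotonicity, at every other place. For a β-redex, moreover, the bound variable is not stuck, so
that the substitution respects the stuck variables. -/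
theorem AllOpSub.contract (hq : Persistent P q) {Γ} {pos : Prop} {e e' : Expr L}
    (h : contract P e = some e') (he : AllOpSub P i k j q Γ pos e) :
    AllOpSub P i k j q Γ pos e' := by
  have hs := not_headStuck_of_contract Γ h
  have up {p p' : Prop} {a : Expr L} (hp : ¬ p) (h : AllOpSub P i k j q Γ p a) :
      AllOpSub P i k j q Γ p' a := h.mono hq (fun _ => id) fun h => (hp h).elim
  induction h using contract_cases with
  | app b a h =>
    obtain ⟨-, h₁, h₂⟩ := he
    rw [inst_eq]
    -- Removing the binder lowers the other indices by one, which `Nat.succ` undoes.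
    refine AllOpSub.subst hq (τ := Nat.succ) (fun n hn => ?_) (fun h => (hs h).elim) (fun n => ?_) h₁
    · cases n with
      | zero => exact (hs hn).elim
      | succ n => exact ⟨n, rfl, hn, rfl⟩
    · cases n with
      | zero => exact up hs h₂
      | succ n => trivial
  | lnil n c h => exact up hs he.2.2.1
  | lcons x t n c h =>
    exact ⟨.of_none rfl, ⟨.of_none rfl, up hs he.2.2.2, up hs he.2.1.2.1⟩, up hs he.2.1.2.2⟩
  | tcons_eq s v t h => exact up hs he.2.2.1
  | tcons_ne s s' v t h hne => exact ⟨.of_none rfl, up hs he.2.2.2⟩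
  | ite_true a b h => exact up hs he.2.2.1
  | ite_false a b h => exact up hs he.2.2.2
  | and_true b h => exact up hs he.2.2
  | and_false b h => trivial
  | or_true b h => trivial
  | or_false b h => exact up hs he.2.2
  | un_val f v w h hw => trivial
  | bin_val f v w u h hu => trivial

/-- A reduction inside an argument keeps stuck places stuck (`childPos_red`), so the invariant of
the sibling arguments survives by monotonicity. -/
theorem AllOpSub.red (hq : Persistent P q) {Γ} {pos : Prop} {e e' : Expr L} (h : Red P e e')
    (he : AllOpSub P i k j q Γ pos e) : AllOpSub P i k j q Γ pos e' := by
  have up {p p' : Prop} {a : Expr L} {Γ} (hp : p → p') (h : AllOpSub P i k j q Γ p a) :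
      AllOpSub P i k j q Γ p' a := h.mono hq (fun _ => id) hp
  induction h generalizing Γ pos with
  | root h => exact he.contract hq h
  | lam h ih => exact ih he
  | @un s _ _ h ih =>
    have hc := childPos_red (Γ := Γ) (pos := pos) (.un s) h
    exact ⟨OpSub.red hq (.un _) h he.1, up hc (ih he.2)⟩
  | @binL s _ _ b h ih =>
    have hc := childPos_red (Γ := Γ) (pos := pos) (.binL s b) h
    exact ⟨OpSub.red hq (.binL _ _) h he.1, up hc (ih he.2.1), up hc he.2.2⟩
  | @binR s a _ _ h ih =>
    have hc := childPos_red (Γ := Γ) (pos := pos) (.binR s a) h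
    exact ⟨OpSub.red hq (.binR _ _) h he.1, up hc he.2.1, up hc (ih he.2.2)⟩
  | @tern1 s _ _ b c h ih =>
    have hc := childPos_red (Γ := Γ) (pos := pos) (.tern1 s b c) h
    exact ⟨OpSub.red hq (.tern1 _ _ _) h he.1, up hc (ih he.2.1), up hc he.2.2.1,
      up hc he.2.2.2⟩
  | @tern2 s a _ _ c h ih =>
    have hc := childPos_red (Γ := Γ) (pos := pos) (.tern2 s a c) h
    exact ⟨OpSub.red hq (.tern2 _ _ _) h he.1, up hc he.2.1, up hc (ih he.2.2.1),
      up hc he.2.2.2⟩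
  | @tern3 s a b _ _ h ih =>
    have hc := childPos_red (Γ := Γ) (pos := pos) (.tern3 s a b) h
    exact ⟨OpSub.red hq (.tern3 _ _ _) h he.1, up hc he.2.1, up hc he.2.2.1,
      up hc (ih he.2.2.2)⟩

theorem AllOpSub.reduces (hq : Persistent P q) {Γ} {pos : Prop} {e e' : Expr L}
    (h : Reduces P e e') (he : AllOpSub P i k j q Γ pos e) : AllOpSub P i k j q Γ pos e' := by
  induction h with
  | refl => exact he
  | tail _ h ih =>
    rw [step_eq_red] at h
    exact ih.red hq h

/-! ## The moves of the heuristic and stuck expressions -/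

/-- The stuck variables at the place `K` of the expression `e`, and whether a lambda in this place is
stuck. -/
def env (P : Prims) : Ctx L → Expr L → (ℕ → Prop) × Prop
  | [], _ => (fun _ => True, True)
  | .lam :: K, e => (upPred (env P K (.lam e)).2 (env P K (.lam e)).1, (env P K (.lam e)).2)
  | f :: K, e => ((env P K (f.plug e)).1,
      childPos P (env P K (f.plug e)).1 (env P K (f.plug e)).2 (f.plug e))

/-- `HeadStuck` and `env` mirror the recursive calls of the three functions. `makeRedex` descends
along the arguments on which `HeadStuck` recurses; `inlineVar` asks whether the binder is at a stuck
place; `contractLam` climbs through lambdas and constructors as `childPos` does. What the functions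
compute as failure is thus the stuckness of the corresponding expression, variable or place. -/
theorem stuck_of_fail (P : Prims) :
    (∀ (K : Ctx L) e, makeRedex P K e = none → HeadStuck P (env P K e).1 e) ∧
    (∀ n (K : Ctx L) e, inlineVar P n K e = none → (env P K e).1 n) ∧
    (∀ (K : Ctx L) e, contractLam P K e = none → (env P K e).2) := by
  apply makeRedex.mutual_induct (P := P)
    (motive1 := fun K e => makeRedex P K e = none → HeadStuck P (env P K e).1 e)
    (motive2 := fun n K e => inlineVar P n K e = none → (env P K e).1 n)
    (motive3 := fun K e => contractLam P K e = none → (env P K e).2)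
  -- The catch-all clause of `makeRedex`: the root symbol is not a strict one, so nothing has to be
  -- proved about the arguments.
  case case12 =>
    intro K e _ h₁ h₂ h₃ h₄ h₅ h₆ h₇ h₈ _ h₁₀ _
    rcases e with _ | _ | _ | ⟨s, _⟩ | ⟨s, _, _⟩ | ⟨s, _, _, _⟩
    case var => exact (h₁ _ rfl).elim
    case lam | leaf => exact trivial
    all_goals cases s <;> simp_all [HeadStuck, Sym1.Strict, Sym2.Strict, Sym3.Strict]
  -- The catch-all clauses of `contractLam`: the parent is an operator or a built-in function, which
  -- is stuck whatever its arguments are.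
  case case26 | case33 | case40 | case43 | case46 | case49 =>
    intro e s
    intros
    cases s <;> simp_all [env, childPos, Frame.plug, HeadStuck, Sym1.Strict, Sym2.Strict,
      Sym3.Strict]
  case case13 | case22 => intros; trivial
  case case1 =>
    intro K e e' hc h
    unfold makeRedex at h
    simp [hc] at h
  -- As the first argument of the primitive function is not a constant, `HeadStuck` says nothing
  -- about the second one.
  case case11 =>
    intro K f a b hne hc ih h
    unfold makeRedex at h
    simp only [hc] at h
    exact fun _ => ⟨hc, ih h, fun _ v _ ha => (hne v ha).elim⟩
  all_goals
    intros
    rename_i h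
    first
      | rw [inlineVar] at h
      | rw [contractLam] at h
      | (rw [makeRedex] at h; simp_all [env, HeadStuck, childPos, Frame.plug])
    try exact ‹_ = none → _› h

theorem step_of_move (P : Prims) :
    (∀ (K : Ctx L) e e', makeRedex P K e = some e' → Step P (plug K e) e') ∧
    (∀ n (K : Ctx L) e e', inlineVar P n K e = some e' → Step P (plug K e) e') ∧
    (∀ (K : Ctx L) e e', contractLam P K e = some e' → Step P (plug K e) e') := by
  apply makeRedex.mutual_induct (P := P)
    (motive1 := fun (K : Ctx L) e => ∀ e', makeRedex P K e = some e' → Step P (plug K e) e')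
    (motive2 := fun n K e => ∀ e', inlineVar P n K e = some e' → Step P (plug K e) e')
    (motive3 := fun K e => ∀ e', contractLam P K e = some e' → Step P (plug K e) e')
  case case1 =>
    intro K e r hc e' h
    unfold makeRedex at h
    simp only [hc, Option.some.injEq] at h
    exact ⟨K, e, r, rfl, hc, h.symm⟩
  case case11 =>
    intro K f a b hne hc ih e' h
    unfold makeRedex at h
    simp only [hc] at h
    exact ih e' h
  case case12 =>
    intros
    rename_i h
    unfold makeRedex at h
    simp only [*] at h
    cases h
  case case13 | case22 =>
    intros
    rename_i h
    simp [inlineVar, contractLam] at h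
  case case26 | case33 | case40 | case43 | case46 | case49 =>
    intro e s
    intros
    cases s <;> simp_all [contractLam]
  all_goals
    intros
    rename_i h
    first
      | rw [inlineVar] at h
      | rw [contractLam] at h
      | (rw [makeRedex] at h; simp_all [plug, Frame.plug])
    try exact ‹∀ e', _ = some e' → _› _ h

end

section

variable {L : Type} {P : Prims}

/-! ## Subexpressions and their places -/

theorem mem_subexprs_plug {K : Ctx L} {f : Frame L} {e : Expr L} {p : Ctx L × Expr L}
    (h : p ∈ subexprs (f :: K) e) : p ∈ subexprs K (f.plug e) := by
  cases f <;> simp [subexprs, Frame.plug, h]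

theorem self_mem_subexprs (K : Ctx L) (e : Expr L) : (K, e) ∈ subexprs K e := by
  cases e <;> simp [subexprs]

theorem mem_subexprs {K : Ctx L} {e : Expr L} {p : Ctx L × Expr L} :
    p ∈ subexprs K e ↔ ∃ K₁, p.1 = K₁ ++ K ∧ plug K₁ p.2 = e := by
  constructor
  · have self {K : Ctx L} {e : Expr L} (h : p = (K, e)) :
        ∃ K₁, p.1 = K₁ ++ K ∧ plug K₁ p.2 = e := ⟨[], by simp [h], by simp [h, plug]⟩
    have sub {K : Ctx L} (f : Frame L) {a : Expr L}
        (h : ∃ K₁, p.1 = K₁ ++ f :: K ∧ plug K₁ p.2 = a) :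
        ∃ K₁, p.1 = K₁ ++ K ∧ plug K₁ p.2 = f.plug a := by
      obtain ⟨K₁, h₁, rfl⟩ := h
      exact ⟨K₁ ++ [f], by simp [h₁], by simp [plug_append, plug]⟩
    intro h
    induction e generalizing K with
    | var n => exact self (by simpa [subexprs] using h)
    | leaf s => exact self (by simpa [subexprs] using h)
    | lam b ih =>
      rcases List.mem_cons.1 h with h | h
      · exact self h
      · exact sub .lam (ih h)
    | un s a ih =>
      rcases List.mem_cons.1 h with h | h
      · exact self h
      · exact sub (.un s) (ih h)
    | bin s a b iha ihb =>
      simp only [subexprs, List.mem_cons, List.mem_append] at h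
      rcases h with h | h | h
      · exact self h
      · exact sub (.binL s b) (iha h)
      · exact sub (.binR s a) (ihb h)
    | tern s a b c iha ihb ihc =>
      simp only [subexprs, List.mem_cons, List.mem_append] at h
      rcases h with h | (h | h) | h
      · exact self h
      · exact sub (.tern1 s b c) (iha h)
      · exact sub (.tern2 s a c) (ihb h)
      · exact sub (.tern3 s a b) (ihc h)
  · rintro ⟨K₁, h, rfl⟩
    obtain ⟨K', o⟩ := p
    subst h
    induction K₁ using List.reverseRecOn generalizing K with
    | nil => exact self_mem_subexprs K o
    | append_singleton K₁ f ih =>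
      simp only [plug_append, plug, List.append_assoc, List.singleton_append]
      exact mem_subexprs_plug ih

theorem mem_opPaths {e : Expr L} {p : Ctx L × Expr L} :
    p ∈ opPaths e ↔ plug p.1 p.2 = e ∧ p.2.opInfo ≠ none := by
  simp only [opPaths, List.mem_filter, mem_subexprs, List.append_nil, exists_eq_left',
    Option.isSome_iff_ne_none]

/-- `env` computes from the context of a place the same data that `AllOpSub` accumulates on the way
down from the root. -/
theorem AllOpSub.of_env {i : L} {k : OpKind} {j : ℕ} {q : (ℕ → Prop) → Expr L → Prop} (K : Ctx L)
    (e : Expr L)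
    (h : ∀ K₁ o, plug K₁ o = e → OpSub i k j (q (env P (K₁ ++ K) o).1) o) :
    AllOpSub P i k j q (env P K e).1 (env P K e).2 e := by
  have sub {K : Ctx L} {f : Frame L} {a : Expr L}
      (h : ∀ K₁ o, plug K₁ o = f.plug a → OpSub i k j (q (env P (K₁ ++ K) o).1) o) :
      ∀ K₁ o, plug K₁ o = a → OpSub i k j (q (env P (K₁ ++ f :: K) o).1) o := by
    rintro K₁ o rfl
    have := h (K₁ ++ [f]) o (by simp [plug_append, plug])
    rwa [List.append_assoc] at this
  induction e generalizing K with
  | var n => trivial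
  | leaf s => trivial
  | lam b ih => exact ih _ (sub (f := .lam) h)
  | un s a ih => exact ⟨h [] _ rfl, ih _ (sub (f := .un s) h)⟩
  | bin s a b iha ihb =>
    exact ⟨h [] _ rfl, iha _ (sub (f := .binL s b) h), ihb _ (sub (f := .binR s a) h)⟩
  | tern s a b c iha ihb ihc =>
    exact ⟨h [] _ rfl, iha _ (sub (f := .tern1 s b c) h), ihb _ (sub (f := .tern2 s a c) h),
      ihc _ (sub (f := .tern3 s a b) h)⟩

theorem AllOpSub.exists_opSub {i : L} {k : OpKind} {j : ℕ} {q : (ℕ → Prop) → Expr L → Prop}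
    {Γ : ℕ → Prop} {pos : Prop} {K : Ctx L} {o : Expr L}
    (h : AllOpSub P i k j q Γ pos (plug K o)) : ∃ Γ', OpSub i k j (q Γ') o := by
  have key : ∃ Γ' pos', AllOpSub P i k j q Γ' pos' o := by
    induction K generalizing o with
    | nil => exact ⟨Γ, pos, h⟩
    | cons f K ih =>
      obtain ⟨Γ', pos', h⟩ := ih h
      cases f
      · exact ⟨_, _, h⟩
      · exact ⟨_, _, h.2⟩
      · exact ⟨_, _, h.2.1⟩
      · exact ⟨_, _, h.2.2⟩
      · exact ⟨_, _, h.2.1⟩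
      · exact ⟨_, _, h.2.2.1⟩
      · exact ⟨_, _, h.2.2.2⟩
  obtain ⟨Γ', pos', h⟩ := key
  cases o
  · exact ⟨Γ', .of_none rfl⟩
  · exact ⟨Γ', .of_none rfl⟩
  · exact ⟨Γ', .of_none rfl⟩
  · exact ⟨Γ', h.1⟩
  · exact ⟨Γ', h.1⟩
  · exact ⟨Γ', h.1⟩

/-! ## Persistent properties of the subexpressions of operators -/

theorem headStuck_of_opInfo {e : Expr L} (Γ : ℕ → Prop) (h : e.opInfo ≠ none) :
    HeadStuck P Γ e := by
  rcases e with n | b | s | ⟨s, a⟩ | ⟨s, a, b⟩ | ⟨s, a, b, c⟩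
  case var => exact (h rfl).elim
  case lam | leaf => trivial
  all_goals cases s <;> first | exact False.elim | exact (h rfl).elim

/-- Used in two ways: for an argument that is an operator, hence trivially stuck, and for a child on
which `makeRedex` failed, whatever its root symbol is. -/
theorem persistent_headStuck (x : Option (OpKind × L)) :
    Persistent P fun Γ (c : Expr L) => HeadStuck P Γ c ∧ c.opInfo = x where
  subst hσ h := by
    obtain ⟨h₁, h₂⟩ := h.1.subst hσ
    exact ⟨h₁, by rw [← opInfo_root, h₂, opInfo_root, h.2]⟩
  red hr h := by
    obtain ⟨h₁, h₂⟩ := h.1.red hr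
    exact ⟨h₁, by rw [← opInfo_root, h₂, opInfo_root, h.2]⟩

/-- The free variables of an expression satisfy `Γ`. -/
def FreeIn (Γ : ℕ → Prop) : Expr L → Prop
  | .var n => Γ n
  | .lam b => FreeIn (upPred True Γ) b
  | .leaf _ => True
  | .un _ a => FreeIn Γ a
  | .bin _ a b => FreeIn Γ a ∧ FreeIn Γ b
  | .tern _ a b c => FreeIn Γ a ∧ FreeIn Γ b ∧ FreeIn Γ c

/-- On expressions with only stuck free variables the substitution is a renaming with left inverse
`τ`; this is why `Respects` includes one. -/
theorem FreeIn.subst {Γ Γ' : ℕ → Prop} {σ : ℕ → Expr L} {τ : ℕ → ℕ} (hσ : Respects Γ Γ' σ τ)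
    {e : Expr L} (he : FreeIn Γ e) :
    FreeIn Γ' (e.subst σ) ∧ (e.subst σ).rename τ = e := by
  induction e generalizing Γ Γ' σ τ with
  | var n =>
    obtain ⟨m, h, hm, hτ⟩ := hσ n he
    simp only [Expr.subst, h, Expr.rename, hτ]
    exact ⟨hm, trivial⟩
  | lam b ih =>
    obtain ⟨h₁, h₂⟩ := ih (hσ.up id) he
    exact ⟨h₁, congrArg _ h₂⟩
  | leaf s => exact ⟨trivial, rfl⟩
  | un s a ih =>
    obtain ⟨h₁, h₂⟩ := ih hσ he
    exact ⟨h₁, congrArg _ h₂⟩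
  | bin s a b iha ihb =>
    obtain ⟨h₁, h₂⟩ := iha hσ he.1
    obtain ⟨h₃, h₄⟩ := ihb hσ he.2
    exact ⟨⟨h₁, h₃⟩, by simp only [Expr.subst, Expr.rename, h₂, h₄]⟩
  | tern s a b c iha ihb ihc =>
    obtain ⟨h₁, h₂⟩ := iha hσ he.1
    obtain ⟨h₃, h₄⟩ := ihb hσ he.2.1
    obtain ⟨h₅, h₆⟩ := ihc hσ he.2.2
    exact ⟨⟨h₁, h₃, h₅⟩, by simp only [Expr.subst, Expr.rename, h₂, h₄, h₆]⟩

theorem FreeIn.mono {Γ Γ' : ℕ → Prop} (h : ∀ n, Γ n → Γ' n) {e : Expr L} (he : FreeIn Γ e) :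
    FreeIn Γ' e := by
  have := (he.subst (Respects.of_le h)).1
  rwa [subst_var] at this

/-- A substitution only renames such an expression, and a reduction of it would give one of its
renaming `C`. The original `C` is kept as a renaming of the current expression, so that support can
be transferred back from a reduct. -/
theorem persistent_freeIn {C : Expr L} (hC : ∀ C', ¬ Red P C C') :
    Persistent P fun Γ (c : Expr L) => FreeIn Γ c ∧ ∃ r, c.rename r = C where
  subst {Γ Γ' σ τ c} hσ h := by
    obtain ⟨h, r, rfl⟩ := h
    obtain ⟨h₁, h₂⟩ := h.subst hσ
    exact ⟨h₁, r ∘ τ, by rw [← rename_rename, h₂]⟩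
  red {Γ c c'} hr h := by
    obtain ⟨h, r, rfl⟩ := h
    exact (hC _ (hr.rename r)).elim

theorem not_red_of_subexprs {K : Ctx L} {e : Expr L}
    (h : ∀ p ∈ subexprs K e, contract P p.2 = none) (e' : Expr L) : ¬ Red P e e' := by
  rw [← step_eq_red]
  rintro ⟨K₁, r, r', rfl, hr, -⟩
  rw [h (K₁ ++ K, r) (mem_subexprs.2 ⟨K₁, rfl, rfl⟩)] at hr
  cases hr

/-- Here `m` counts the lambdas above the configuration and `d` those between its root and `K`. The
test `lamCount p.1 ≤ n + m` then says that `n` is not bound inside the configuration. -/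
theorem freeIn_of_subexprs {K : Ctx L} {e : Expr L} {m d : ℕ} (hd : lamCount K = m + d)
    (h : ∀ p ∈ subexprs K e, ∀ n, p.2 = .var n → lamCount p.1 ≤ n + m → (env P p.1 p.2).1 n) :
    FreeIn (fun n => n < d ∨ (env P K e).1 n) e := by
  have sub {K : Ctx L} {f : Frame L} {a : Expr L} (h : ∀ p ∈ subexprs K (f.plug a),
      ∀ n, p.2 = .var n → lamCount p.1 ≤ n + m → (env P p.1 p.2).1 n) :
      ∀ p ∈ subexprs (f :: K) a,
        ∀ n, p.2 = .var n → lamCount p.1 ≤ n + m → (env P p.1 p.2).1 n :=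
    fun p hp => h p (mem_subexprs_plug hp)
  induction e generalizing K d with
  | var n =>
    by_cases hn : n < d
    · exact .inl hn
    · exact .inr (h _ (self_mem_subexprs _ _) n rfl (by simp only [hd]; omega))
  | lam b ih =>
    refine (ih (K := .lam :: K) (d := d + 1) (by simp [lamCount, hd, add_assoc])
      (sub h)).mono fun n hn => ?_
    cases n with
    | zero => trivial
    | succ n => exact hn.imp Nat.lt_of_succ_lt_succ id
  | leaf s => trivial
  | un s a ih => exact ih (K := .un s :: K) hd (sub h)
  | bin s a b iha ihb =>
    exact ⟨iha (K := .binL s b :: K) hd (sub h), ihb (K := .binR s a :: K) hd (sub h)⟩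
  | tern s a b c iha ihb ihc =>
    exact ⟨iha (K := .tern1 s b c :: K) hd (sub h), ihb (K := .tern2 s a c :: K) hd (sub h),
      ihc (K := .tern3 s a b :: K) hd (sub h)⟩

theorem immediate_getElem {K : Ctx L} {o c : Expr L} {j : ℕ} (ho : o.opInfo ≠ none)
    (h : (subs o)[j]? = some c) :
    ∃ f : Frame L, (immediate K o)[j]? = some (f :: K, c) ∧ f.plug c = o ∧ f ≠ .lam := by
  rcases o with _ | _ | _ | ⟨s, a⟩ | ⟨s, a, b⟩ | ⟨s, a, b, d⟩
  case var | lam | leaf => exact (ho rfl).elim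
  all_goals
    rcases j with _ | _ | _ | j <;> cases h
    all_goals exact ⟨_, rfl, rfl, by simp⟩

theorem env_frame {K : Ctx L} {f : Frame L} {c : Expr L} (hf : f ≠ .lam) :
    (env P (f :: K) c).1 = (env P K (f.plug c)).1 := by
  cases f <;> first | rfl | exact (hf rfl).elim

theorem stuck_configs {K : Ctx Unit} {o c : Expr Unit} {k : OpKind} {j : ℕ}
    (ho : o.opInfo = some (k, ())) (h : oneRedConfig P K o = none) (hj : j < k.numConfigs)
    (hc : (subs o)[j]? = some c) :
    FreeIn (env P K o).1 c ∧ ∀ c', ¬ Red P c c' := by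
  obtain ⟨f, hf, rfl, hne⟩ := immediate_getElem (K := K) (by simp [ho]) hc
  have hmem : (f :: K, c) ∈ opConfigs K (f.plug c) := by
    simp only [opConfigs, ho]
    exact List.mem_of_getElem? (i := j) (by rw [List.getElem?_take, if_pos hj, hf])
  simp only [oneRedConfig, List.head?_eq_none_iff, List.append_eq_nil_iff,
    List.filterMap_eq_nil_iff] at h
  obtain ⟨h₁, h₂⟩ := h
  rw [← env_frame hne]
  constructor
  · refine (freeIn_of_subexprs (P := P) (K := f :: K) (m := lamCount (f :: K)) (d := 0) rfl
      fun p hp n hn hl => ?_).mono fun n hn => hn.resolve_left (Nat.not_lt_zero n)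
    have := h₁ (p.1, n) (by
      simp only [configFreeVars, List.mem_flatMap, List.mem_filterMap]
      exact ⟨_, hmem, p, hp, by simp [hn, hl]⟩)
    rw [hn]
    exact (stuck_of_fail P).2.1 _ _ _ this
  · refine not_red_of_subexprs (K := f :: K) fun p hp => ?_
    by_contra hcp
    obtain ⟨r, hr⟩ := Option.ne_none_iff_exists'.1 hcp
    have : plug p.1 r ∈ configContractions P K (f.plug c) := by
      simp only [configContractions, List.mem_flatMap, List.mem_filterMap]
      exact ⟨_, hmem, p, hp, by simp [hr]⟩
    rw [h₂] at this
    cases this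

theorem stuck_children {K : Ctx Unit} {o c : Expr Unit} {k : OpKind} {j : ℕ}
    (ho : o.opInfo = some (k, ())) (h : oneRedChild P K o = none) (hj : k.numConfigs ≤ j)
    (hc : (subs o)[j]? = some c) : HeadStuck P (env P K o).1 c := by
  obtain ⟨f, hf, rfl, hne⟩ := immediate_getElem (K := K) (by simp [ho]) hc
  have hmem : (f :: K, c) ∈ opChildren K (f.plug c) := by
    simp only [opChildren, ho]
    refine List.mem_of_getElem? (i := j - k.numConfigs) ?_
    rw [List.getElem?_drop, Nat.add_sub_cancel' hj, hf]
  simp only [oneRedChild, List.head?_eq_none_iff, List.filterMap_eq_nil_iff] at h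
  rw [← env_frame hne]
  exact (stuck_of_fail P).1 _ _ (h _ hmem)

/-! ## Stuckness and erasure of identifiers -/

/-- Forgetting identifiers. -/
def Frame.erase : Frame L → Frame Unit
  | .lam => .lam
  | .un s => .un s.erase
  | .binL s b => .binL s.erase b.erase
  | .binR s a => .binR s.erase a.erase
  | .tern1 s b c => .tern1 s.erase b.erase c.erase
  | .tern2 s a c => .tern2 s.erase a.erase c.erase
  | .tern3 s a b => .tern3 s.erase a.erase b.erase

theorem erase_frame_plug (f : Frame L) (e : Expr L) :
    (f.plug e).erase = f.erase.plug e.erase := by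
  cases f <;> rfl

theorem erase_plug (K : Ctx L) (e : Expr L) :
    (plug K e).erase = plug (K.map Frame.erase) e.erase := by
  induction K generalizing e with
  | nil => rfl
  | cons f K ih => simp only [plug, List.map_cons, ih, erase_frame_plug]

theorem opInfo_erase (e : Expr L) :
    e.erase.opInfo = e.opInfo.map fun x => (x.1, ()) := by
  rcases e with _ | _ | _ | ⟨s, _⟩ | ⟨s, _, _⟩ | ⟨s, _, _, _⟩ <;> try rfl
  all_goals cases s <;> rfl

theorem subs_erase (e : Expr L) : subs e.erase = (subs e).map Expr.erase := by
  cases e <;> rfl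

theorem erase_eq_leaf {e : Expr L} {s : Sym0} : e.erase = .leaf s ↔ e = .leaf s := by
  cases e <;> simp [Expr.erase]

/-- The moves work on unlabelled expressions, while operators are followed in labelled ones;
stuckness can be transferred because it ignores identifiers. -/
theorem headStuck_erase {Γ : ℕ → Prop} (e : Expr L) :
    HeadStuck P Γ e.erase ↔ HeadStuck P Γ e := by
  induction e with
  | var n => rfl
  | lam b _ => rfl
  | leaf s => rfl
  | un s a ih =>
    have := contract_erase P (.un s a)
    cases s <;> simp_all [HeadStuck, Expr.erase, Sym1.erase, Sym1.Strict]
  | bin s a b iha ihb =>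
    have := contract_erase P (.bin s a b)
    cases s <;> simp_all [HeadStuck, Expr.erase, Sym2.erase, Sym2.Strict, erase_eq_leaf]
  | tern s a b c iha _ _ =>
    have := contract_erase P (.tern s a b c)
    cases s <;> simp_all [HeadStuck, Expr.erase, Sym3.erase, Sym3.Strict]

theorem childPos_erase {Γ : ℕ → Prop} {pos : Prop} (e : Expr L) :
    childPos P Γ pos e.erase = childPos P Γ pos e := by
  have key := propext (headStuck_erase (P := P) (Γ := Γ) e)
  rcases e with _ | _ | _ | _ | ⟨s, _, _⟩ | _
  case bin => cases s <;> first | rfl | exact key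
  all_goals first | rfl | exact key

theorem env_erase (K : Ctx L) (e : Expr L) :
    env P (K.map Frame.erase) e.erase = env P K e := by
  induction K generalizing e with
  | nil => rfl
  | cons f K ih =>
    have h := ih (f.plug e)
    rw [erase_frame_plug] at h
    have hc := childPos_erase (P := P) (Γ := (env P K (f.plug e)).1)
      (pos := (env P K (f.plug e)).2) (f.plug e)
    rw [erase_frame_plug] at hc
    cases f
    case lam =>
      exact congrArg (fun x : (ℕ → Prop) × Prop => (upPred x.2 x.1, x.2)) h
    all_goals
      simp only [List.map_cons, Frame.erase, env] at h hc ⊢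
      rw [h, hc]

theorem freeIn_erase {Γ : ℕ → Prop} (e : Expr L) : FreeIn Γ e.erase ↔ FreeIn Γ e := by
  induction e generalizing Γ <;> simp_all [FreeIn, Expr.erase]

end

section

/-! ## Search spaces -/

/-- Every sequence of `r`-steps from `x` has length at most `n`. -/
def Bounded {α : Type*} (r : α → α → Prop) : ℕ → α → Prop
  | 0, x => ∀ y, ¬ r x y
  | n + 1, x => ∀ y, r x y → Bounded r n y

theorem Bounded.succ {α : Type*} {r : α → α → Prop} {n : ℕ} {x : α} (h : Bounded r n x) :
    Bounded r (n + 1) x := by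
  induction n generalizing x with
  | zero => exact fun y hy => (h y hy).elim
  | succ n ih => exact fun y hy => ih (h y hy)

theorem Bounded.mono {α : Type*} {r : α → α → Prop} {m n : ℕ} (hmn : m ≤ n) {x : α}
    (h : Bounded r m x) : Bounded r n x := by
  induction hmn with
  | refl => exact h
  | step _ ih => exact ih.succ

theorem Bounded.of_le {α : Type*} {r r' : α → α → Prop} (hr : ∀ x y, r' x y → r x y) {n : ℕ}
    {x : α} (h : Bounded r n x) : Bounded r' n x := by
  induction n generalizing x with
  | zero => exact fun y hy => h y (hr _ _ hy)
  | succ n ih => exact fun y hy => ih (h y (hr _ _ hy))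

theorem Bounded.reflTransGen {α : Type*} {r : α → α → Prop} {n : ℕ} {x y : α}
    (h : Bounded r n x) (hxy : Relation.ReflTransGen r x y) : Bounded r n y := by
  induction hxy with
  | refl => exact h
  | tail _ hr ih =>
    cases n with
    | zero => exact (ih _ hr).elim
    | succ n => exact (ih _ hr).succ

/-- König's lemma: with finite branching, termination gives a uniform bound. The required fuel comes
from here. -/
theorem exists_bounded {α : Type*} {r : α → α → Prop} (hfin : ∀ x, {y | r x y}.Finite) {x : α}
    (hx : Acc (fun a b => r b a) x) : ∃ n, Bounded r n x := by
  induction hx with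
  | intro x _ ih =>
    choose! N hN using ih
    obtain ⟨M, hM⟩ := ((hfin x).image N).bddAbove
    exact ⟨M + 1, fun y hy => (hN y hy).mono (hM ⟨y, hy, rfl⟩)⟩

/-- `y` is the result of a move on an operator of `x`. -/
def Move (next : Ctx Unit → Expr Unit → Option (Expr Unit)) (x y : Expr Unit) : Prop :=
  ∃ p ∈ opPaths x, next p.1 p.2 = some y

theorem finite_move (next : Ctx Unit → Expr Unit → Option (Expr Unit)) (x : Expr Unit) :
    {y | Move next x y}.Finite := by
  refine ((opPaths x).filterMap fun p => next p.1 p.2).finite_toSet.subset fun y hy => ?_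
  exact List.mem_filterMap.2 hy

/-- No sequence of moves from `x` leads to an expression of smaller measure than `y`. -/
def Exhausted (D : Database) (next : Ctx Unit → Expr Unit → Option (Expr Unit))
    (x y : Expr Unit) : Prop :=
  ∀ z, Relation.ReflTransGen (Move next) x z → ¬ measure D z < measure D y

/-- The leftmost leaf of a pruned tree lies in its first surviving child, if there is one. -/
theorem pruneChildren_cases (x : Expr Unit) (ts : List Tree) :
    ((∀ t ∈ ts, prune t = .node x []) ∧ pruneChildren x ts = []) ∨
      ∃ t ∈ ts, prune t ≠ .node x [] ∧ ∃ us, pruneChildren x ts = prune t :: us := by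
  induction ts with
  | nil => exact .inl ⟨by simp, by simp [pruneChildren]⟩
  | cons t ts ih =>
    by_cases ht : prune t = .node x []
    · have heq : pruneChildren x (t :: ts) = pruneChildren x ts := by
        rw [pruneChildren, ht]
        simp
      rw [heq]
      refine ih.imp (fun h => ⟨?_, h.2⟩) fun ⟨u, hu, h⟩ => ⟨u, List.mem_cons_of_mem _ hu, h⟩
      simpa [ht] using h.1
    · refine .inr ⟨t, List.mem_cons_self, ht, pruneChildren x ts, ?_⟩
      rw [pruneChildren]
      rcases hp : prune t with ⟨y, _ | ⟨u, us⟩⟩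
      · have hne : y ≠ x := fun h => ht (by rw [hp, h])
        simp [hne]
      · rfl

variable {D : Database} {next : Ctx Unit → Expr Unit → Option (Expr Unit)}

/-- The outcome of the search below `cur`, the label of the parent being `x`. -/
def SearchOutcome (D : Database) (next : Ctx Unit → Expr Unit → Option (Expr Unit))
    (cur x : Expr Unit) (p : Ctx Unit × Expr Unit) (t : Tree) : Prop :=
  (t = .node x [] ∧ ∀ e', next p.1 p.2 = some e' → Exhausted D next e' x) ∨
    (t ≠ .node x [] ∧ Relation.ReflTransGen (Move next) cur t.leftmostLeaf ∧
      Exhausted D next t.leftmostLeaf t.leftmostLeaf)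

/-- The outcome of the search at a node, from the outcomes of the search at its children. -/
theorem prune_node_outcome {cur x : Expr Unit} {f : Ctx Unit × Expr Unit → Tree}
    (hx : ¬ measure D cur < measure D x)
    (h : ∀ p ∈ opPaths cur, SearchOutcome D next cur x p (prune (f p))) :
    (prune (.node x ((opPaths cur).map f)) = .node x [] ∧ Exhausted D next cur x) ∨
      (prune (.node x ((opPaths cur).map f)) ≠ .node x [] ∧
        Relation.ReflTransGen (Move next) cur
          (prune (.node x ((opPaths cur).map f))).leftmostLeaf ∧
        Exhausted D next (prune (.node x ((opPaths cur).map f))).leftmostLeaf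
          (prune (.node x ((opPaths cur).map f))).leftmostLeaf) := by
  rw [prune]
  rcases pruneChildren_cases x ((opPaths cur).map f) with ⟨hall, heq⟩ | ⟨t, ht, hne, us, heq⟩
  · refine .inl ⟨by rw [heq], fun z hz => ?_⟩
    rcases hz.cases_head with rfl | ⟨y, ⟨p, hp, hy⟩, hz⟩
    · exact hx
    rcases h p hp with ⟨-, h⟩ | ⟨h, -⟩
    · exact h y hy z hz
    · exact (h (hall _ (List.mem_map_of_mem hp))).elim
  · rw [heq, Tree.leftmostLeaf]
    obtain ⟨p, hp, rfl⟩ := List.mem_map.1 ht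
    rcases h p hp with ⟨h, -⟩ | ⟨-, h⟩
    · exact (hne h).elim
    · exact .inr ⟨by simp, h⟩

/-- The remaining fuel exceeds the length of every remaining sequence of moves, so a branch ends
only where the move fails. A subtree is then pruned away only after a complete search without
improvement. -/
theorem searchTree_outcome {Φ n : ℕ} {cur x : Expr Unit} {φ : ℕ} {p : Ctx Unit × Expr Unit}
    (hb : Bounded (Move next) n cur) (hp : p ∈ opPaths cur) (hφ : n < φ) (hΦ : n < Φ) :
    SearchOutcome D next cur x p (prune (searchTree D next Φ φ x p)) := by
  induction n using Nat.strong_induction_on generalizing cur x φ p with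
  | _ n ih =>
    obtain ⟨φ, rfl⟩ := Nat.exists_eq_succ_of_ne_zero (Nat.ne_zero_of_lt hφ)
    rcases hn : next p.1 p.2 with _ | e'
    · refine .inl ⟨?_, by simp [hn]⟩
      rw [searchTree.eq_2 _ _ _ _ _ _ hn]
      simp [prune, pruneChildren]
    have hm : Move next cur e' := ⟨p, hp, hn⟩
    rcases n with _ | n
    · exact (hb _ hm).elim
    have hb' : Bounded (Move next) n e' := hb _ hm
    rw [searchTree.eq_3 _ _ _ _ _ _ _ hn]
    by_cases hlt : measure D e' < measure D x
    · simp only [hlt, dite_true]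
      refine .inr ?_
      rcases prune_node_outcome (D := D) (next := next) (lt_irrefl (measure D e')) (fun q hq =>
        ih n (Nat.lt_succ_self n) (x := e') hb' hq (by omega : n < Φ) (by omega))
        with ⟨h₁, h₂⟩ | ⟨h₁, h₂, h₃⟩
      -- The leaf `e'` is not pruned under a parent `x`, since its measure is smaller.
      · rw [h₁, Tree.leftmostLeaf]
        refine ⟨fun h => ?_, .single hm, h₂⟩
        cases h
        exact lt_irrefl _ hlt
      · refine ⟨fun h => ?_, .head hm h₂, h₃⟩
        rw [prune] at h
        rw [(Tree.node.inj h).1] at hlt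
        exact lt_irrefl _ hlt
    · simp only [hlt, dite_false]
      rcases prune_node_outcome (D := D) (next := next) hlt (fun q hq =>
        ih n (Nat.lt_succ_self n) (x := x) hb' hq (by omega : n < φ) (by omega))
        with ⟨h₁, h₂⟩ | ⟨h₁, h₂, h₃⟩
      · refine .inl ⟨h₁, fun e'' he => ?_⟩
        cases hn.symm.trans he
        exact h₂
      · exact .inr ⟨h₁, .head hm h₂, h₃⟩

theorem passResult_spec {Φ n : ℕ} {e : Expr Unit} (hb : Bounded (Move next) n e) (hΦ : n < Φ) :
    Relation.ReflTransGen (Move next) e (passResult D next Φ e) ∧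
      Exhausted D next (passResult D next Φ e) (passResult D next Φ e) := by
  rw [passResult, searchSpace]
  rcases prune_node_outcome (D := D) (next := next) (lt_irrefl (measure D e)) (fun q hq =>
    searchTree_outcome (x := e) hb hq hΦ hΦ) with ⟨h₁, h₂⟩ | ⟨-, h⟩
  · rw [h₁, Tree.leftmostLeaf]
    exact ⟨.refl, h₂⟩
  · exact h

end

section

variable {L : Type} {P : Prims} {D : Database}

/-! ## Identifiers -/

/-- The identifier of an expression that is an operator. -/
def ownIds (e : Expr L) : List L := (e.opInfo.map Prod.snd).toList

/-- The identifiers of the operators of an expression, by recursion on the expression. -/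
def idList : Expr L → List L
  | .var _ => []
  | .lam b => idList b
  | .leaf _ => []
  | .un s a => ownIds (.un s a) ++ idList a
  | .bin s a b => ownIds (.bin s a b) ++ (idList a ++ idList b)
  | .tern s a b c => ownIds (.tern s a b c) ++ (idList a ++ idList b ++ idList c)

theorem filterMap_subexprs (K : Ctx L) (e : Expr L) :
    (subexprs K e).filterMap (fun p => p.2.opInfo.map Prod.snd) = idList e := by
  have cons (p : Ctx L × Expr L) (l : List (Ctx L × Expr L)) :
      (p :: l).filterMap (fun p => p.2.opInfo.map Prod.snd) =
        ownIds p.2 ++ l.filterMap (fun p => p.2.opInfo.map Prod.snd) := by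
    rw [List.filterMap_cons, ownIds]
    cases p.2.opInfo <;> rfl
  induction e generalizing K with
  | var n => rfl
  | leaf s => rfl
  | lam b ih => rw [subexprs, cons, ih]; rfl
  | un s a ih => rw [subexprs, cons, ih]; rfl
  | bin s a b iha ihb => rw [subexprs, cons, List.filterMap_append, iha, ihb]; rfl
  | tern s a b c iha ihb ihc =>
    rw [subexprs, cons, List.filterMap_append, List.filterMap_append, iha, ihb, ihc]; rfl

theorem opIds_eq (f : Expr ℕ) : opIds f = idList f := by
  rw [opIds, opPaths, List.filterMap_filter, ← filterMap_subexprs []]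
  congr 1
  funext p
  cases p.2.opInfo <;> rfl

theorem mem_opIds {f : Expr ℕ} {i : ℕ} :
    i ∈ opIds f ↔ ∃ K o k, plug K o = f ∧ o.opInfo = some (k, i) := by
  simp only [opIds, List.mem_filterMap, mem_opPaths, Option.map_eq_some_iff, Prod.exists,
    exists_eq_right]
  constructor
  · rintro ⟨K, o, ⟨h, -⟩, k, hk⟩
    exact ⟨K, o, k, h, hk⟩
  · rintro ⟨K, o, k, h, hk⟩
    exact ⟨K, o, ⟨h, by simp [hk]⟩, k, hk⟩

theorem eq_of_nodup {f : Expr ℕ} (hf : (opIds f).Nodup) {K K' : Ctx ℕ} {o o' : Expr ℕ}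
    {k k' : OpKind} {i : ℕ} (h : plug K o = f) (h' : plug K' o' = f)
    (ho : o.opInfo = some (k, i)) (ho' : o'.opInfo = some (k', i)) : K = K' ∧ o = o' := by
  have key : ∀ l : List (Ctx ℕ × Expr ℕ),
      (l.filterMap fun p => p.2.opInfo.map Prod.snd).Nodup → ∀ p ∈ l, ∀ p' ∈ l,
      p.2.opInfo.map Prod.snd = some i → p'.2.opInfo.map Prod.snd = some i → p = p' := by
    intro l
    induction l with
    | nil => simp
    | cons q l ih =>
      intro hl p hp p' hp' hi hi'
      have mem {p : Ctx ℕ × Expr ℕ} (hp : p ∈ l) (hi : p.2.opInfo.map Prod.snd = some i) :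
          i ∈ l.filterMap fun p => p.2.opInfo.map Prod.snd := List.mem_filterMap.2 ⟨p, hp, hi⟩
      have hl' := hl.sublist ((List.sublist_cons_self q l).filterMap _)
      rcases List.mem_cons.1 hp with h₁ | h₁ <;> rcases List.mem_cons.1 hp' with h₂ | h₂
      · rw [h₁, h₂]
      · rw [List.filterMap_cons, ← h₁, hi] at hl
        exact ((List.nodup_cons.1 hl).1 (mem h₂ hi')).elim
      · rw [List.filterMap_cons, ← h₂, hi'] at hl
        exact ((List.nodup_cons.1 hl).1 (mem h₁ hi)).elim
      · exact ih hl' p h₁ p' h₂ hi hi'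
  have := key (opPaths f) hf (K, o) (mem_opPaths.2 ⟨h, by simp [ho]⟩) (K', o')
    (mem_opPaths.2 ⟨h', by simp [ho']⟩) (by simp [ho]) (by simp [ho'])
  exact Prod.mk.inj this

/-- Attaching the identifier `n`. -/
def Sym1.label (n : ℕ) : Sym1 Unit → Sym1 ℕ
  | .tdestr s => .tdestr s
  | .val f => .val f
  | .builtin g => .builtin g
  | .scan _ => .scan n

/-- Attaching the identifier `n`. -/
def Sym2.label (n : ℕ) : Sym2 Unit → Sym2 ℕ
  | .app => .app
  | .lcons => .lcons
  | .tcons s => .tcons s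
  | .and => .and
  | .or => .or
  | .val f => .val f
  | .select _ => .select n
  | .project _ => .project n
  | .sort _ => .sort n
  | .topk _ => .topk n

/-- Attaching the identifier `n`. -/
def Sym3.label (n : ℕ) : Sym3 Unit → Sym3 ℕ
  | .ldestr => .ldestr
  | .ite => .ite
  | .group _ => .group n
  | .join _ => .join n

theorem exists_isLabelling (e : Expr Unit) : ∃ f, IsLabelling f e := by
  have bound (l : List ℕ) (n : ℕ) : ∃ m, n ≤ m ∧ ∀ i ∈ l, i < m := by
    obtain ⟨m, hm⟩ := l.toFinset.bddAbove
    exact ⟨max n (m + 1), le_max_left _ _, fun i hi =>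
      lt_max_of_lt_right (Nat.lt_succ_of_le (hm (by simpa using hi)))⟩
  have own {l : List ℕ} {n : ℕ} (x : List ℕ) (hx : x = [] ∨ x = [n]) (hl : l.Nodup)
      (hn : ∀ i ∈ l, n < i) : (x ++ l).Nodup ∧ ∀ i ∈ x ++ l, n ≤ i := by
    rcases hx with rfl | rfl
    · exact ⟨hl, fun i hi => (hn i hi).le⟩
    · refine ⟨List.nodup_cons.2 ⟨fun h => lt_irrefl _ (hn _ h), hl⟩, fun i hi => ?_⟩
      rcases List.mem_cons.1 hi with rfl | hi
      · exact le_rfl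
      · exact (hn i hi).le
  have app {l l' : List ℕ} {n m : ℕ} (hnm : n ≤ m) (hl : l.Nodup) (hl' : l'.Nodup)
      (hm : ∀ i ∈ l, i < m) (hm' : ∀ i ∈ l', m ≤ i) (hn : ∀ i ∈ l, n ≤ i) :
      (l ++ l').Nodup ∧ ∀ i ∈ l ++ l', n ≤ i := by
    refine ⟨List.nodup_append.2 ⟨hl, hl', fun i hi j hj => ?_⟩, fun i hi => ?_⟩
    · exact ((hm i hi).trans_le (hm' j hj)).ne
    · rcases List.mem_append.1 hi with hi | hi
      · exact hn i hi
      · exact hnm.trans (hm' i hi)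
  -- The root takes the identifier `n`, and each argument uses identifiers above those of the
  -- preceding ones.
  have key : ∀ n, ∃ f : Expr ℕ, f.erase = e ∧ (idList f).Nodup ∧ ∀ i ∈ idList f, n ≤ i := by
    induction e with
    | var n => exact fun _ => ⟨.var n, rfl, by simp [idList], by simp [idList]⟩
    | leaf s => exact fun _ => ⟨.leaf s, rfl, by simp [idList], by simp [idList]⟩
    | lam b ih =>
      intro n
      obtain ⟨f, rfl, h⟩ := ih n
      exact ⟨.lam f, rfl, h⟩
    | un s a ih =>
      intro n
      obtain ⟨f, rfl, h, hn⟩ := ih (n + 1)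
      refine ⟨.un (s.label n) f, by cases s <;> rfl, own _ ?_ h hn⟩
      cases s <;> first | exact .inl rfl | exact .inr rfl
    | bin s a b iha ihb =>
      intro n
      obtain ⟨f, rfl, h, hn⟩ := iha (n + 1)
      obtain ⟨m, hnm, hm⟩ := bound (idList f) (n + 1)
      obtain ⟨g, rfl, h', hn'⟩ := ihb m
      obtain ⟨h₁, h₂⟩ := app hnm h h' hm hn' hn
      refine ⟨.bin (s.label n) f g, by cases s <;> rfl, own _ ?_ h₁ h₂⟩
      cases s <;> first | exact .inl rfl | exact .inr rfl
    | tern s a b c iha ihb ihc =>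
      intro n
      obtain ⟨f, rfl, h, hn⟩ := iha (n + 1)
      obtain ⟨m, hnm, hm⟩ := bound (idList f) (n + 1)
      obtain ⟨g, rfl, h', hn'⟩ := ihb m
      obtain ⟨h₁, h₂⟩ := app hnm h h' hm hn' hn
      obtain ⟨m', hnm', hm'⟩ := bound (idList f ++ idList g) (n + 1)
      obtain ⟨x, rfl, h'', hn''⟩ := ihc m'
      obtain ⟨h₃, h₄⟩ := app hnm' h₁ h'' hm' hn'' h₂
      refine ⟨.tern (s.label n) f g x, by cases s <;> rfl, own _ ?_ h₃ h₄⟩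
      cases s <;> first | exact .inl rfl | exact .inr rfl
  obtain ⟨f, hf, h, -⟩ := key 0
  exact ⟨f, hf, by rwa [opIds_eq]⟩

/-! ## Expressions whose operators are neither erased nor duplicated -/

/-- The invariant is started at the root of the whole expression, where all free variables and the
place itself are stuck. -/
theorem opSub_of_reduces {i : L} {k : OpKind} {j : ℕ} {q : (ℕ → Prop) → Expr L → Prop}
    (hq : Persistent P q) {f f' : Expr L}
    (h : ∀ K o, plug K o = f → OpSub i k j (q (env P K o).1) o) (hr : Reduces P f f')
    {K' : Ctx L} {o' : Expr L} (ho : plug K' o' = f') : ∃ Γ, OpSub i k j (q Γ) o' := by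
  subst ho
  have := AllOpSub.of_env (P := P) (q := q) [] f (by simpa using h)
  exact (this.reduces hq hr).exists_opSub

/-- If `i` does not occur in `f`, then "every operator with identifier `i` is of kind `k'`" holds
vacuously for each `k'` and persists. An operator with identifier `i` in a reduct would have all
kinds at once. -/
theorem mem_opIds_of_reduces {f f' : Expr ℕ} (h : Reduces P f f') {i : ℕ} (hi : i ∈ opIds f') :
    i ∈ opIds f := by
  by_contra hf
  obtain ⟨K', o', k, h', ho'⟩ := mem_opIds.1 hi
  have hq : Persistent P fun _ (_ : Expr ℕ) => True := ⟨fun _ _ => trivial, fun _ _ => trivial⟩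
  have key (k' : OpKind) : k = k' := by
    obtain ⟨_, h⟩ := opSub_of_reduces (i := i) (k := k') (j := 0) hq
      (fun K o hK k₁ hk₁ => (hf (mem_opIds.2 ⟨K, o, k₁, hK, hk₁⟩)).elim) h h'
    exact (h k ho').1
  cases (key .scan).symm.trans (key .select)

/-- The operators of `f` have different identifiers, and each of them has exactly one occurrence in
every reduct of `f`. -/
def Linear (P : Prims) (f : Expr ℕ) : Prop :=
  (opIds f).Nodup ∧ ∀ f', Reduces P f f' → (opIds f').Perm (opIds f)

theorem linear_of_fixedOperators {f : Expr ℕ} {e : Expr Unit} (hf : IsLabelling f e)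
    (he : FixedOperators P e) : Linear P f := by
  refine ⟨hf.2, fun f' h => List.perm_iff_count.2 fun i => ?_⟩
  by_cases hi : i ∈ opIds f
  · obtain ⟨h₀, h₁⟩ := he f hf i hi
    have h₂ : numOcc i f' ≠ 0 := fun h' => h₀ ⟨f', h, h'⟩
    have h₃ : ¬ 1 < numOcc i f' := fun h' => h₁ ⟨f', h, h'⟩
    rw [List.count_eq_one_of_mem hf.2 hi]
    change numOcc i f' = 1
    omega
  · rw [List.count_eq_zero_of_not_mem hi,
      List.count_eq_zero_of_not_mem fun h' => hi (mem_opIds_of_reduces h h')]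

theorem Linear.reduces {f f' : Expr ℕ} (hf : Linear P f) (h : Reduces P f f') : Linear P f' :=
  ⟨(hf.2 f' h).nodup_iff.2 hf.1, fun f'' h' => (hf.2 f'' (h.trans h')).trans (hf.2 f' h).symm⟩

theorem Linear.exists_op {f f' : Expr ℕ} (hf : Linear P f) (h : Reduces P f f') {K : Ctx ℕ}
    {o : Expr ℕ} {k : OpKind} {i : ℕ} (hK : plug K o = f) (ho : o.opInfo = some (k, i)) :
    ∃ K' o' k', plug K' o' = f' ∧ o'.opInfo = some (k', i) :=
  mem_opIds.1 ((hf.2 f' h).mem_iff.2 (mem_opIds.2 ⟨K, o, k, hK, ho⟩))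

/-- The number of immediate subexpressions of an operator. -/
def OpKind.arity : OpKind → ℕ
  | .scan => 1
  | .group => 3
  | .join => 3
  | _ => 2

theorem length_subs {e : Expr L} {k : OpKind} {i : L} (h : e.opInfo = some (k, i)) :
    (subs e).length = k.arity := by
  rcases e with _ | _ | _ | ⟨s, _⟩ | ⟨s, _, _⟩ | ⟨s, _, _, _⟩ <;> try cases h
  all_goals cases s <;> cases h <;> rfl

/-- Since identifiers are distinct, a property of the one operator `o` is a property of all
operators with its identifier, as `AllOpSub` demands. -/
theorem Linear.persistent {f f' : Expr ℕ} (hf : Linear P f) (h : Reduces P f f')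
    {q : (ℕ → Prop) → Expr ℕ → Prop} (hq : Persistent P q) {K K' : Ctx ℕ} {o o' c : Expr ℕ}
    {k k' : OpKind} {i j : ℕ} (hK : plug K o = f) (ho : o.opInfo = some (k, i))
    (hc : (subs o)[j]? = some c) (hqc : q (env P K o).1 c) (hK' : plug K' o' = f')
    (ho' : o'.opInfo = some (k', i)) : k' = k ∧ ∃ c' Γ, (subs o')[j]? = some c' ∧ q Γ c' := by
  obtain ⟨Γ, h⟩ := opSub_of_reduces (i := i) (k := k) (j := j) hq (fun K₁ o₁ hK₁ k₁ ho₁ => by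
    obtain ⟨rfl, rfl⟩ := eq_of_nodup hf.1 hK hK₁ ho ho₁
    cases ho.symm.trans ho₁
    refine ⟨rfl, fun c' hc' => ?_⟩
    cases hc.symm.trans hc'
    exact hqc) h hK'
  obtain ⟨rfl, h₁⟩ := h k' ho'
  have hj : j < (subs o').length := by
    rw [length_subs ho', ← length_subs ho]
    exact (List.getElem?_eq_some_iff.1 hc).1
  exact ⟨rfl, _, Γ, List.getElem?_eq_getElem hj, h₁ _ (List.getElem?_eq_getElem hj)⟩

theorem Linear.opKind {f f' : Expr ℕ} (hf : Linear P f) (h : Reduces P f f') {K K' : Ctx ℕ}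
    {o o' : Expr ℕ} {k k' : OpKind} {i : ℕ} (hK : plug K o = f) (ho : o.opInfo = some (k, i))
    (hK' : plug K' o' = f') (ho' : o'.opInfo = some (k', i)) : k' = k := by
  have hpos : 0 < (subs o).length := by
    rw [length_subs ho]
    cases k <;> simp [OpKind.arity]
  exact (hf.persistent h (q := fun _ _ => True) ⟨fun _ _ => trivial, fun _ _ => trivial⟩ hK ho
    (List.getElem?_eq_getElem hpos) trivial hK' ho').1

/-- An operator is always head stuck, so it can never leave its position as an immediate argument of
another operator. -/
theorem Linear.persistent_opInfo {f f' : Expr ℕ} (hf : Linear P f) (h : Reduces P f f')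
    {K K' : Ctx ℕ} {o o' c : Expr ℕ} {k k' : OpKind} {i j : ℕ} {x : OpKind × ℕ}
    (hK : plug K o = f) (ho : o.opInfo = some (k, i)) (hc : (subs o)[j]? = some c)
    (hx : c.opInfo = some x) (hK' : plug K' o' = f') (ho' : o'.opInfo = some (k', i)) :
    k' = k ∧ ∃ c', (subs o')[j]? = some c' ∧ c'.opInfo = some x := by
  obtain ⟨hk, c', _, hc', -, hx'⟩ := hf.persistent h (persistent_headStuck (some x)) hK ho hc
    ⟨headStuck_of_opInfo _ (by simp [hx]), hx⟩ hK' ho'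
  exact ⟨hk, c', hc', hx'⟩

/-! ## The measure in terms of identifiers -/

theorem subexprs_erase (K : Ctx L) (e : Expr L) :
    subexprs (K.map Frame.erase) e.erase =
      (subexprs K e).map fun p => (p.1.map Frame.erase, p.2.erase) := by
  induction e generalizing K with
  | var n => rfl
  | leaf s => rfl
  | lam b ih => simp [subexprs, Expr.erase, ← ih, Frame.erase]
  | un s a ih => simp [subexprs, Expr.erase, ← ih, Frame.erase]
  | bin s a b iha ihb => simp [subexprs, Expr.erase, ← iha, ← ihb, Frame.erase]
  | tern s a b c iha ihb ihc => simp [subexprs, Expr.erase, ← iha, ← ihb, ← ihc, Frame.erase]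

theorem opPaths_erase (f : Expr L) :
    opPaths f.erase = (opPaths f).map fun p => (p.1.map Frame.erase, p.2.erase) := by
  have := subexprs_erase [] f
  simp only [List.map_nil] at this
  simp only [opPaths, this, List.filter_map, Function.comp_def, opInfo_erase, Option.isSome_map]

/-- The operator of `f` with identifier `i` is compatible. -/
def CompatAt (D : Database) (f : Expr ℕ) (i : ℕ) : Prop :=
  ∃ K o k, plug K o = f ∧ o.opInfo = some (k, i) ∧ Compatible D o.erase

/-- The parent of the operator of `f` with identifier `i` is a compatible operator. -/
def ParentCompatAt (D : Database) (f : Expr ℕ) (i : ℕ) : Prop :=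
  ∃ (K : Ctx ℕ) (o : Expr ℕ) (k : OpKind) (a j : ℕ) (c : Expr ℕ) (k' : OpKind), plug K o = f ∧ o.opInfo = some (k, a) ∧ Compatible D o.erase ∧
    (subs o)[j]? = some c ∧ c.opInfo = some (k', i)

theorem Compatible.opInfo {e : Expr Unit} (h : Compatible D e) : e.opInfo ≠ none := by
  obtain ⟨k, hk, -⟩ := h
  simp [hk]

theorem compatAt_iff {f : Expr ℕ} (hf : (opIds f).Nodup) {K : Ctx ℕ} {o : Expr ℕ} {k : OpKind}
    {i : ℕ} (hK : plug K o = f) (ho : o.opInfo = some (k, i)) :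
    CompatAt D f i ↔ Compatible D o.erase := by
  refine ⟨?_, fun h => ⟨K, o, k, hK, ho, h⟩⟩
  rintro ⟨K', o', k', hK', ho', h⟩
  obtain ⟨rfl, rfl⟩ := eq_of_nodup hf hK hK' ho ho'
  exact h

theorem isFragmentRoot_iff {f : Expr ℕ} (hf : (opIds f).Nodup) {K : Ctx ℕ} {o : Expr ℕ}
    {k : OpKind} {i : ℕ} (hK : plug K o = f) (ho : o.opInfo = some (k, i)) :
    IsFragmentRoot D (K.map Frame.erase) o.erase ↔ CompatAt D f i ∧ ¬ ParentCompatAt D f i := by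
  rw [IsFragmentRoot.eq_def, compatAt_iff hf hK ho]
  refine and_congr_right fun _ => ?_
  have key : ParentCompatAt D f i ↔
      ∃ g K', K = g :: K' ∧ Compatible D (g.plug o).erase := by
    constructor
    · rintro ⟨K₁, o₁, k₁, a, j, c, k', hK₁, ho₁, hcomp, hc, hi⟩
      obtain ⟨g, -, rfl, -⟩ := immediate_getElem (K := K₁) (by simp [ho₁]) hc
      obtain ⟨rfl, rfl⟩ := eq_of_nodup (K' := g :: K₁) hf hK hK₁ ho hi
      exact ⟨g, K₁, rfl, hcomp⟩
    · rintro ⟨g, K', rfl, hcomp⟩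
      have hne := hcomp.opInfo
      rw [opInfo_erase, ne_eq, Option.map_eq_none_iff] at hne
      obtain ⟨⟨k₁, a⟩, ha⟩ := Option.ne_none_iff_exists'.1 hne
      obtain ⟨l, l', hl⟩ := subs_plug g
      exact ⟨K', g.plug o, k₁, a, l.length, o, k, hK, ha, hcomp, by simp [hl], ho⟩
  rw [key]
  rcases K with _ | ⟨g, K'⟩
  · simp
  · simp [erase_frame_plug]

theorem length_filter_eq_card {α : Type*} {l : List α} {g : α → Option ℕ}
    (hl : (l.filterMap g).Nodup) {Q : α → Prop} [DecidablePred Q] {R : ℕ → Prop}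
    [DecidablePred R] (h : ∀ a ∈ l, ∃ i, g a = some i ∧ (Q a ↔ R i)) :
    (l.filter fun a => decide (Q a)).length = ((l.filterMap g).toFinset.filter R).card := by
  have key : (l.filter fun a => decide (Q a)).length =
      ((l.filterMap g).filter fun i => decide (R i)).length := by
    clear hl
    induction l with
    | nil => rfl
    | cons a l ih =>
      have ih := ih fun b hb => h b (List.mem_cons_of_mem _ hb)
      obtain ⟨i, hi, hQ⟩ := h a List.mem_cons_self
      rw [List.filterMap_cons, hi]
      by_cases hR : R i
      · simp [hR, hQ.2 hR, ih]
      · simp [hR, mt hQ.1 hR, ih]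
  rw [key, ← List.toFinset_card_of_nodup (hl.filter _), List.toFinset_filter]
  simp

open Classical in
/-- The identifiers of the compatible operators. -/
noncomputable def compatIds (D : Database) (f : Expr ℕ) : Finset ℕ :=
  (opIds f).toFinset.filter (CompatAt D f)

open Classical in
/-- The identifiers of the roots of the fragments. -/
noncomputable def fragIds (D : Database) (f : Expr ℕ) : Finset ℕ :=
  (opIds f).toFinset.filter fun i => CompatAt D f i ∧ ¬ ParentCompatAt D f i

/-- Counting identifiers instead of places makes the measures of different reducts comparable
through inclusions of finite sets. -/
theorem measure_erase {f : Expr ℕ} (hf : (opIds f).Nodup) :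
    measure D f.erase =
      toLex ((opIds f).length - (compatIds D f).card, (fragIds D f).card) := by
  have hmem {p : Ctx ℕ × Expr ℕ} (hp : p ∈ opPaths f) :
      ∃ k i, plug p.1 p.2 = f ∧ p.2.opInfo = some (k, i) := by
    obtain ⟨h, hne⟩ := mem_opPaths.1 hp
    obtain ⟨⟨k, i⟩, hi⟩ := Option.ne_none_iff_exists'.1 hne
    exact ⟨k, i, h, hi⟩
  have h₁ : numOps f.erase = (opIds f).length := by
    rw [numOps, opPaths_erase, List.length_map, opIds]
    generalize hl : opPaths f = l at hmem
    clear hl hf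
    induction l with
    | nil => rfl
    | cons p l ih =>
      obtain ⟨k, i, -, hi⟩ := hmem List.mem_cons_self
      rw [List.filterMap_cons, hi]
      simp [ih fun hp => hmem (List.mem_cons_of_mem _ hp)]
  have h₂ : numCompat D f.erase = (compatIds D f).card := by
    classical
    rw [numCompat, opPaths_erase, List.filter_map, List.length_map, compatIds]
    refine length_filter_eq_card hf fun p hp => ?_
    obtain ⟨k, i, h, hi⟩ := hmem hp
    exact ⟨i, by simp [hi], (compatAt_iff hf h hi).symm⟩
  have h₃ : numFrags D f.erase = (fragIds D f).card := by
    classical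
    rw [numFrags, opPaths_erase, List.filter_map, List.length_map, fragIds]
    refine length_filter_eq_card hf fun p hp => ?_
    obtain ⟨k, i, h, hi⟩ := hmem hp
    exact ⟨i, by simp [hi], isFragmentRoot_iff hf h hi⟩
  rw [measure, h₁, h₂, h₃]

theorem CompatAt.mem {f : Expr ℕ} {i : ℕ} (h : CompatAt D f i) : i ∈ opIds f := by
  obtain ⟨K, o, k, hK, ho, -⟩ := h
  exact mem_opIds.2 ⟨K, o, k, hK, ho⟩

theorem CompatAt.reduces (hD : StableCompatibility P D) {f f' : Expr ℕ} (hf : Linear P f)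
    (h : Reduces P f f') {i : ℕ} (hi : CompatAt D f i) : CompatAt D f' i := by
  obtain ⟨K, o, k, hK, ho, hc⟩ := hi
  obtain ⟨K', o', k', hK', ho'⟩ := hf.exists_op h hK ho
  exact ⟨K', o', k', hK', ho', hD f.erase f f' ⟨rfl, hf.1⟩ h (K, o)
    (mem_opPaths.2 ⟨hK, by simp [ho]⟩) (K', o') (mem_opPaths.2 ⟨hK', by simp [ho']⟩)
    (by simp [ho, ho']) hc⟩

theorem ParentCompatAt.reduces (hD : StableCompatibility P D) {f f' : Expr ℕ} (hf : Linear P f)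
    (h : Reduces P f f') {i : ℕ} (hi : ParentCompatAt D f i) : ParentCompatAt D f' i := by
  obtain ⟨K, o, k, a, j, c, k', hK, ho, hcomp, hc, hci⟩ := hi
  obtain ⟨K', o', k₁, hK', ho', hcomp'⟩ :=
    CompatAt.reduces hD hf h ⟨K, o, k, hK, ho, hcomp⟩
  obtain ⟨rfl, c', hc', hci'⟩ := hf.persistent_opInfo h hK ho hc hci hK' ho'
  exact ⟨K', o', _, a, j, c', k', hK', ho', hcomp', hc', hci'⟩

theorem mem_compatIds {f : Expr ℕ} {i : ℕ} : i ∈ compatIds D f ↔ CompatAt D f i := by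
  simp only [compatIds, Finset.mem_filter, List.mem_toFinset, and_iff_right_iff_imp]
  exact CompatAt.mem

theorem mem_fragIds {f : Expr ℕ} {i : ℕ} :
    i ∈ fragIds D f ↔ CompatAt D f i ∧ ¬ ParentCompatAt D f i := by
  simp only [fragIds, Finset.mem_filter, List.mem_toFinset, and_iff_right_iff_imp]
  exact fun h => h.1.mem

theorem compatIds_subset (hD : StableCompatibility P D) {f f' : Expr ℕ} (hf : Linear P f)
    (h : Reduces P f f') : compatIds D f ⊆ compatIds D f' := fun _ hi =>
  mem_compatIds.2 ((mem_compatIds.1 hi).reduces hD hf h)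

/-- Having a compatible parent is never lost, so fragments can merge but not split. Equality of the
compatible sets excludes new roots that come from newly compatible operators. -/
theorem fragIds_subset (hD : StableCompatibility P D) {f f' : Expr ℕ} (hf : Linear P f)
    (h : Reduces P f f') (hc : compatIds D f = compatIds D f') : fragIds D f' ⊆ fragIds D f := by
  intro i hi
  obtain ⟨h₁, h₂⟩ := mem_fragIds.1 hi
  rw [← mem_compatIds, ← hc, mem_compatIds] at h₁
  exact mem_fragIds.2 ⟨h₁, fun h₃ => h₂ (h₃.reduces hD hf h)⟩

theorem compatIds_card_le (f : Expr ℕ) (hf : (opIds f).Nodup) :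
    (compatIds D f).card ≤ (opIds f).length := by
  classical
  rw [← List.toFinset_card_of_nodup hf, compatIds]
  exact Finset.card_filter_le _ _

theorem measure_lt_of_compatIds (hD : StableCompatibility P D) {f f' : Expr ℕ}
    (hf : Linear P f) (h : Reduces P f f') (hne : compatIds D f ≠ compatIds D f') :
    measure D f'.erase < measure D f.erase := by
  have hf' := hf.reduces h
  rw [measure_erase hf.1, measure_erase hf'.1, (hf.2 f' h).length_eq]
  have hlt := Finset.card_lt_card ((compatIds_subset hD hf h).ssubset_of_ne hne)
  -- This bound makes the truncated subtraction strictly decreasing.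
  have hle := compatIds_card_le (D := D) f' hf'.1
  rw [(hf.2 f' h).length_eq] at hle
  exact Prod.Lex.toLex_lt_toLex.2 (.inl (by dsimp only; omega))

theorem measure_le_of_reduces (hD : StableCompatibility P D) {f f' : Expr ℕ}
    (hf : Linear P f) (h : Reduces P f f') : measure D f'.erase ≤ measure D f.erase := by
  by_cases hc : compatIds D f = compatIds D f'
  · rw [measure_erase hf.1, measure_erase (hf.reduces h).1, (hf.2 f' h).length_eq, hc]
    exact Prod.Lex.toLex_le_toLex.2
      (.inr ⟨rfl, Finset.card_le_card (fragIds_subset hD hf h hc)⟩)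
  · exact (measure_lt_of_compatIds hD hf h hc).le

theorem compatAt_of_not_lt (hD : StableCompatibility P D) {f f' : Expr ℕ} (hf : Linear P f)
    (h : Reduces P f f') (hm : ¬ measure D f'.erase < measure D f.erase) {i : ℕ}
    (hi : CompatAt D f' i) : CompatAt D f i := by
  rw [← mem_compatIds] at hi ⊢
  by_cases hc : compatIds D f = compatIds D f'
  · rwa [hc]
  · exact (hm (measure_lt_of_compatIds hD hf h hc)).elim

/-- Both inclusions, of compatible operators and of fragment roots, must be equalities, since a
strict one would decrease the measure. -/
theorem parentCompatAt_of_not_lt (hD : StableCompatibility P D) {f f' : Expr ℕ}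
    (hf : Linear P f) (h : Reduces P f f') (hm : ¬ measure D f'.erase < measure D f.erase) {i : ℕ}
    (hi : CompatAt D f' i) (hp : ParentCompatAt D f' i) : ParentCompatAt D f i := by
  have hc : compatIds D f = compatIds D f' := by
    by_contra hc
    exact hm (measure_lt_of_compatIds hD hf h hc)
  have heq : fragIds D f' = fragIds D f := by
    by_contra hne
    refine hm ?_
    rw [measure_erase hf.1, measure_erase (hf.reduces h).1, (hf.2 f' h).length_eq, hc]
    exact Prod.Lex.toLex_lt_toLex.2 (.inr ⟨rfl,
      Finset.card_lt_card ((fragIds_subset hD hf h hc).ssubset_of_ne hne)⟩)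
  by_contra hn
  have := mem_fragIds.2 ⟨compatAt_of_not_lt hD hf h hm hi, hn⟩
  rw [← heq, mem_fragIds] at this
  exact this.2 hp

theorem measure_le_of_reflect (hD : StableCompatibility P D) {f f' : Expr ℕ} (hf : Linear P f)
    (h : Reduces P f f') (hc : ∀ i, CompatAt D f' i → CompatAt D f i)
    (hp : ∀ i, CompatAt D f' i → ParentCompatAt D f' i → ParentCompatAt D f i) :
    measure D f.erase ≤ measure D f'.erase := by
  have heq : compatIds D f = compatIds D f' :=
    (compatIds_subset hD hf h).antisymm fun i hi => mem_compatIds.2 (hc i (mem_compatIds.1 hi))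
  have hsub : fragIds D f ⊆ fragIds D f' := by
    intro i hi
    obtain ⟨h₁, h₂⟩ := mem_fragIds.1 hi
    have h₃ := h₁.reduces hD hf h
    exact mem_fragIds.2 ⟨h₃, fun h₄ => h₂ (hp i h₃ h₄)⟩
  rw [measure_erase hf.1, measure_erase (hf.reduces h).1, (hf.2 f' h).length_eq, heq]
  exact Prod.Lex.toLex_le_toLex.2 (.inr ⟨rfl, Finset.card_le_card hsub⟩)

end

section

variable {L : Type} {P : Prims} {D : Database}

/-! ## Compatibility and renaming -/

/-- The renaming performed by the substitution of `var m` for the variable of index `0`. -/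
def instRen (m : ℕ) : ℕ → ℕ
  | 0 => m
  | n + 1 => n

theorem inst_var (e : Expr L) (m : ℕ) : e.inst (.var m) = e.rename (instRen m) := by
  rw [inst_eq, rename_eq_subst]
  congr 1
  funext n; cases n <;> rfl

/-- Each `instRen m` chooses the image of index `0` and shifts the others down, so `N` of them in
succession choose the images of the first `N` indices. -/
theorem exists_rename_eq {X : Expr L → Prop} (hX : ∀ e m, X e → X (e.rename (instRen m)))
    (N : ℕ) (r : ℕ → ℕ) {e : Expr L} (he : X e) :
    ∃ g, X (e.rename g) ∧ (∀ n < N, g n = r n) ∧ ∀ n, N ≤ n → g n = n - N := by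
  induction N generalizing r e with
  | zero => exact ⟨id, by rwa [rename_id], by simp, by simp⟩
  | succ N ih =>
    -- The summand `N` compensates for the `N` downward shifts still to come.
    obtain ⟨g, hg, h₁, h₂⟩ := ih (fun n => r (n + 1)) (hX e (r 0 + N) he)
    refine ⟨g ∘ instRen (r 0 + N), by rwa [← rename_rename], fun n hn => ?_, fun n hn => ?_⟩
    · cases n with
      | zero => exact (h₂ (r 0 + N) (by omega)).trans (Nat.add_sub_cancel _ _)
      | succ n => exact h₁ n (by omega)
    · cases n with
      | zero => omega
      | succ n =>
        have := h₂ n (by omega)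
        simp only [Function.comp, instRen, this]
        omega

theorem exists_rename_congr (e : Expr L) :
    ∃ N, ∀ r r' : ℕ → ℕ, (∀ n < N, r n = r' n) → e.rename r = e.rename r' := by
  induction e with
  | var n => exact ⟨n + 1, fun r r' h => by simp [Expr.rename, h n (Nat.lt_succ_self n)]⟩
  | leaf s => exact ⟨0, fun _ _ _ => rfl⟩
  | lam b ih =>
    obtain ⟨N, h⟩ := ih
    refine ⟨N, fun r r' hr => congrArg _ (h _ _ fun n hn => ?_)⟩
    cases n with
    | zero => rfl
    | succ n => exact congrArg _ (hr n (by omega))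
  | un s a ih =>
    obtain ⟨N, h⟩ := ih
    exact ⟨N, fun r r' hr => congrArg _ (h _ _ hr)⟩
  | bin s a b iha ihb =>
    obtain ⟨N, h⟩ := iha
    obtain ⟨M, h'⟩ := ihb
    refine ⟨max N M, fun r r' hr => ?_⟩
    simp only [Expr.rename, h r r' fun n hn => hr n (lt_max_of_lt_left hn),
      h' r r' fun n hn => hr n (lt_max_of_lt_right hn)]
  | tern s a b c iha ihb ihc =>
    obtain ⟨N, h⟩ := iha
    obtain ⟨M, h'⟩ := ihb
    obtain ⟨O, h''⟩ := ihc
    refine ⟨max N (max M O), fun r r' hr => ?_⟩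
    simp only [Expr.rename, h r r' fun n hn => hr n (by omega),
      h' r r' fun n hn => hr n (by omega), h'' r r' fun n hn => hr n (by omega)]

/-- Stable compatibility is applied to the β-redex `(λ. o) m`, whose contractum is the renamed
operator. -/
theorem Compatible.rename_instRen (hD : StableCompatibility P D) {o : Expr Unit}
    (ho : Compatible D o) (m : ℕ) : Compatible D (o.rename (instRen m)) := by
  obtain ⟨f, hf⟩ := exists_isLabelling (.bin .app (.lam o) (.var m))
  obtain ⟨o₁, rfl, rfl⟩ : ∃ o₁ : Expr ℕ, f = .bin .app (.lam o₁) (.var m) ∧ o₁.erase = o := by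
    obtain ⟨hf, -⟩ := hf
    rcases f with _ | _ | _ | _ | ⟨s, a, b⟩ | _ <;> simp only [Expr.erase, reduceCtorEq] at hf
    rcases a with _ | a | _ | _ | _ | _ <;> simp [Expr.erase] at hf
    rcases b with _ | _ | _ | _ | _ | _ <;> simp [Expr.erase] at hf
    cases s <;> simp [Sym2.erase] at hf
    exact ⟨a, by rw [hf.2], hf.1⟩
  have hne : o₁.opInfo ≠ none := by
    have := ho.opInfo
    rwa [opInfo_erase, ne_eq, Option.map_eq_none_iff] at this
  have heq : (o₁.inst (.var m)).opInfo = o₁.opInfo := by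
    rw [inst_eq]; exact opInfo_subst hne _
  have := hD _ _ (o₁.inst (.var m)) hf (Red.root rfl).reduces
    ([.lam, .binL .app (.var m)], o₁) (mem_opPaths.2 ⟨rfl, hne⟩) ([], o₁.inst (.var m))
    (mem_opPaths.2 ⟨rfl, by rwa [heq]⟩) (by rw [heq]) ho
  rwa [inst_var, erase_rename] at this

theorem Compatible.rename (hD : StableCompatibility P D) {o : Expr Unit} (ho : Compatible D o)
    (r : ℕ → ℕ) : Compatible D (o.rename r) := by
  obtain ⟨N, hN⟩ := exists_rename_congr o
  obtain ⟨g, hg, h, -⟩ :=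
    exists_rename_eq (X := Compatible D) (fun _ m he => he.rename_instRen hD m) N r ho
  rwa [hN g r h] at hg

theorem immediate_snd (K : Ctx L) (e : Expr L) : (immediate K e).map Prod.snd = subs e := by
  cases e <;> rfl

theorem compatible_iff {o : Expr Unit} {k : OpKind} (ho : o.opInfo = some (k, ())) :
    Compatible D o ↔ D.supportsOp k ∧
      ∀ j < k.numConfigs, ∀ c, (subs o)[j]? = some c → D.supportsConfig k c := by
  have key (c : Expr Unit) : (∃ x ∈ opConfigs [] o, x.2 = c) ↔
      ∃ j < k.numConfigs, (subs o)[j]? = some c := by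
    rw [← List.mem_map (f := Prod.snd), opConfigs, ho]
    simp only [List.map_take, immediate_snd, List.mem_iff_getElem?, List.getElem?_take]
    refine exists_congr fun j => ?_
    split_ifs with h <;> simp [h]
  constructor
  · rintro ⟨k', hk, h₁, h₂⟩
    cases ho.symm.trans hk
    refine ⟨h₁, fun j hj c hc => ?_⟩
    obtain ⟨x, hx, rfl⟩ := (key c).2 ⟨j, hj, hc⟩
    exact h₂ x hx
  · rintro ⟨h₁, h₂⟩
    refine ⟨k, ho, h₁, fun x hx => ?_⟩
    obtain ⟨j, hj, hc⟩ := (key x.2).1 ⟨x, hx, rfl⟩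
    exact h₂ j hj _ hc

/-- An operator of kind `k` all of whose arguments are `c`. -/
def diagOp (c : Expr Unit) : OpKind → Expr Unit
  | .scan => .un (.scan ()) c
  | .select => .bin (.select ()) c c
  | .project => .bin (.project ()) c c
  | .sort => .bin (.sort ()) c c
  | .topk => .bin (.topk ()) c c
  | .group => .tern (.group ()) c c c
  | .join => .tern (.join ()) c c c

theorem compatible_diagOp (c : Expr Unit) (k : OpKind) :
    Compatible D (diagOp c k) ↔ D.supportsOp k ∧ D.supportsConfig k c := by
  rw [compatible_iff (k := k) (by cases k <;> rfl)]
  refine and_congr_right fun _ => ⟨fun h => ?_, fun h j _ c' hc' => ?_⟩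
  · exact h 0 (by cases k <;> simp [OpKind.numConfigs]) c (by cases k <;> rfl)
  · have := List.mem_of_getElem? hc'
    obtain rfl : c' = c := by cases k <;> simpa [diagOp, subs] using this
    exact h

/-- Stable compatibility speaks of whole operators, so `c` is first made the only configuration, up
to repetition, of the operator `diagOp c k`. -/
theorem supportsConfig_rename (hD : StableCompatibility P D) {k : OpKind} {c : Expr Unit}
    (hk : D.supportsOp k) (hc : D.supportsConfig k c) (r : ℕ → ℕ) :
    D.supportsConfig k (c.rename r) := by
  have := ((compatible_diagOp c k).2 ⟨hk, hc⟩).rename hD r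
  have heq : (diagOp c k).rename r = diagOp (c.rename r) k := by cases k <;> rfl
  rw [heq, compatible_diagOp] at this
  exact this.2

/-! ## Performing moves as long as possible -/

theorem plug_of_mem_subexprs {K : Ctx L} {e : Expr L} {p : Ctx L × Expr L}
    (h : p ∈ subexprs K e) : plug p.1 p.2 = plug K e := by
  obtain ⟨K₁, hK, rfl⟩ := mem_subexprs.1 h
  rw [hK, plug_append]

theorem plug_of_mem_immediate {K : Ctx L} {e : Expr L} {p : Ctx L × Expr L}
    (h : p ∈ immediate K e) : plug p.1 p.2 = plug K e := by
  cases e <;> simp only [immediate, List.mem_cons, List.not_mem_nil, or_false] at h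
  · exact h ▸ rfl
  · exact h ▸ rfl
  · rcases h with rfl | rfl <;> rfl
  · rcases h with rfl | rfl | rfl <;> rfl

theorem step_of_oneRedConfig {K : Ctx Unit} {o y : Expr Unit}
    (h : oneRedConfig P K o = some y) : Step P (plug K o) y := by
  have hc {c : Ctx Unit × Expr Unit} (hc : c ∈ opConfigs K o) : plug c.1 c.2 = plug K o := by
    unfold opConfigs at hc
    split at hc
    · exact plug_of_mem_immediate (List.mem_of_mem_take hc)
    · cases hc
  have := List.mem_of_mem_head? h
  simp only [List.mem_append, List.mem_filterMap, configFreeVars, configContractions,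
    List.mem_flatMap] at this
  rcases this with ⟨v, ⟨c, hcm, p, hp, hv⟩, h⟩ | ⟨c, hcm, p, hp, h⟩
  · have hpe := (plug_of_mem_subexprs hp).trans (hc hcm)
    split at hv
    · rename_i n hn
      split_ifs at hv
      cases hv
      rw [← hpe, hn]
      exact (step_of_move P).2.1 _ _ _ _ h
    · cases hv
  · obtain ⟨r, hr, rfl⟩ := Option.map_eq_some_iff.1 h
    exact ⟨p.1, p.2, r, ((plug_of_mem_subexprs hp).trans (hc hcm)).symm, hr, rfl⟩

theorem step_of_oneRedChild {K : Ctx Unit} {o y : Expr Unit}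
    (h : oneRedChild P K o = some y) : Step P (plug K o) y := by
  have := List.mem_of_mem_head? h
  simp only [List.mem_filterMap] at this
  obtain ⟨c, hc, h⟩ := this
  have hcp : plug c.1 c.2 = plug K o := by
    unfold opChildren at hc
    split at hc
    · exact plug_of_mem_immediate (List.mem_of_mem_drop hc)
    · cases hc
  rw [← hcp]
  exact (step_of_move P).1 _ _ _ h

variable {next : Ctx Unit → Expr Unit → Option (Expr Unit)}

theorem Move.step (hn : ∀ K o y, next K o = some y → Step P (plug K o) y) {x y : Expr Unit}
    (h : Move next x y) : Step P x y := by
  obtain ⟨p, hp, h⟩ := h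
  rw [← (mem_opPaths.1 hp).1]
  exact hn _ _ _ h

theorem reduces_of_moves (hn : ∀ K o y, next K o = some y → Step P (plug K o) y) {x y : Expr Unit}
    (h : Relation.ReflTransGen (Move next) x y) : Reduces P x y :=
  Relation.ReflTransGen.mono (fun _ _ h => Move.step hn h) _ _ h

/-- Moves are repeated on the one operator with identifier `a`, which is never erased, until they
fail; strong normalization ends the process. -/
theorem exists_stuck (hn : ∀ K o y, next K o = some y → Step P (plug K o) y) {f : Expr ℕ}
    (hsn : Acc (fun a b => Step P b a) f) (hf : Linear P f) {a : ℕ} (ha : a ∈ opIds f) :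
    ∃ f' K o k, Reduces P f f' ∧ Relation.ReflTransGen (Move next) f.erase f'.erase ∧
      plug K o = f' ∧ o.opInfo = some (k, a) ∧ next (K.map Frame.erase) o.erase = none := by
  induction hsn with
  | intro f _ ih =>
    obtain ⟨K, o, k, hK, ho⟩ := mem_opIds.1 ha
    rcases hnx : next (K.map Frame.erase) o.erase with _ | y
    · exact ⟨f, K, o, k, .refl, .refl, hK, ho, hnx⟩
    · have hmem : (K.map Frame.erase, o.erase) ∈ opPaths f.erase :=
        mem_opPaths.2 ⟨by rw [← erase_plug, hK], by simp [opInfo_erase, ho]⟩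
      have hm : Move next f.erase y := ⟨_, hmem, hnx⟩
      have hs := hm.step hn
      rw [step_eq_red] at hs
      obtain ⟨g, hg, rfl⟩ := hs.lift
      obtain ⟨f', K', o', k', h₁, h₂, h₃⟩ := ih g (by rwa [step_eq_red])
        (hf.reduces hg.reduces) ((hf.2 g hg.reduces).mem_iff.2 ha)
      exact ⟨f', K', o', k', hg.reduces.trans h₁, .head hm h₂, h₃⟩

/-! ## Correctness of the passes -/

/-- Where no sequence of moves on configurations improves the measure, no reduction makes an operator
compatible, or an operator a configuration of a compatible operator. -/
theorem reflect_of_exhausted_config (hD : StableCompatibility P D) {f : Expr ℕ}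
    (hsn : Acc (fun a b => Step P b a) f) (hf : Linear P f)
    (hex : Exhausted D (oneRedConfig P) f.erase f.erase) {w : Expr ℕ} (hw : Reduces P f w)
    {K : Ctx ℕ} {o : Expr ℕ} {k : OpKind} {a : ℕ} (hK : plug K o = w)
    (ho : o.opInfo = some (k, a)) (hcomp : Compatible D o.erase) :
    CompatAt D f a ∧ ∀ j < k.numConfigs, ∀ c k' i, (subs o)[j]? = some c →
      c.opInfo = some (k', i) → CompatAt D f i → ParentCompatAt D f i := by
  have ha : a ∈ opIds f := mem_opIds_of_reduces hw (mem_opIds.2 ⟨K, o, k, hK, ho⟩)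
  obtain ⟨z, K₁, o₁, k₁, hz, hmz, hK₁, ho₁, hstuck⟩ :=
    exists_stuck (fun _ _ _ => step_of_oneRedConfig (P := P)) hsn hf ha
  have hlz := hf.reduces hz
  have hlw := hf.reduces hw
  obtain ⟨v, hzv, hwv⟩ := reduces_join hsn hz hw
  obtain ⟨K₂, o₂, k₂, hK₂, ho₂, hcomp₂⟩ :=
    CompatAt.reduces hD hlw hwv ⟨K, o, k, hK, ho, hcomp⟩
  have ho₁' : o₁.erase.opInfo = some (k₁, ()) := by simp [opInfo_erase, ho₁]
  obtain rfl : k₂ = k₁ := hlz.opKind hzv hK₁ ho₁ hK₂ ho₂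
  -- From `z` to the common reduct `v`, the configurations of this operator change by a renaming
  -- only.
  have stuck_config {j : ℕ} {c : Expr ℕ} (hj : j < k₂.numConfigs) (hc : (subs o₁)[j]? = some c) :
      ∃ c' r, (subs o₂)[j]? = some c' ∧ c'.rename r = c := by
    obtain ⟨h₁, h₂⟩ := stuck_configs ho₁' hstuck hj (c := c.erase) (by simp [subs_erase, hc])
    rw [env_erase, freeIn_erase] at h₁
    obtain ⟨-, c', _, hc', -, r, hr⟩ := hlz.persistent hzv
      (persistent_freeIn fun c' hcc => h₂ _ hcc.erase) hK₁ ho₁ hc ⟨h₁, id, rename_id c⟩ hK₂ ho₂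
    exact ⟨c', r, hc', hr⟩
  have ho₂' : o₂.erase.opInfo = some (k₂, ()) := by simp [opInfo_erase, ho₂]
  have hcomp₁ : Compatible D o₁.erase := by
    rw [compatible_iff ho₂'] at hcomp₂
    rw [compatible_iff ho₁']
    refine ⟨hcomp₂.1, fun j hj c hc => ?_⟩
    rw [subs_erase, List.getElem?_map] at hc
    obtain ⟨c, hc₁, rfl⟩ := Option.map_eq_some_iff.1 hc
    obtain ⟨c', r, hc', rfl⟩ := stuck_config hj hc₁
    rw [erase_rename]
    exact supportsConfig_rename hD hcomp₂.1
      (hcomp₂.2 j hj _ (by rw [subs_erase, List.getElem?_map, hc']; rfl)) r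
  -- `z` is reached by moves, so exhaustion forbids an improvement there, and what holds in `z`
  -- about compatibility is reflected to `f`.
  have hnot := hex _ hmz
  refine ⟨compatAt_of_not_lt hD hf hz hnot ⟨K₁, o₁, k₂, hK₁, ho₁, hcomp₁⟩, ?_⟩
  intro j hj c k' i hc hi hif
  obtain ⟨rfl, c', hc', hi'⟩ := hlw.persistent_opInfo hwv hK ho hc hi hK₂ ho₂
  have hlt : j < (subs o₁).length := by
    rw [length_subs ho₁, ← length_subs ho]
    exact (List.getElem?_eq_some_iff.1 hc).1
  obtain ⟨c'', r, hc'', hr⟩ := stuck_config hj (List.getElem?_eq_getElem hlt)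
  cases hc'.symm.trans hc''
  refine parentCompatAt_of_not_lt hD hf hz hnot (hif.reduces hD hf hz)
    ⟨K₁, o₁, _, a, j, _, k', hK₁, ho₁, hcomp₁, List.getElem?_eq_getElem hlt, ?_⟩
  rw [← hr, rename_eq_subst, opInfo_subst (by simp [hi']), hi']

/-- Where no sequence of moves on children improves the measure, no reduction makes an operator a
child of a compatible operator. -/
theorem reflect_of_exhausted_child (hD : StableCompatibility P D) {f : Expr ℕ}
    (hsn : Acc (fun a b => Step P b a) f) (hf : Linear P f)
    (hex : Exhausted D (oneRedChild P) f.erase f.erase) {w : Expr ℕ} (hw : Reduces P f w)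
    {K : Ctx ℕ} {o c : Expr ℕ} {k k' : OpKind} {a i j : ℕ} (hK : plug K o = w)
    (ho : o.opInfo = some (k, a)) (hj : k.numConfigs ≤ j) (hc : (subs o)[j]? = some c)
    (hi : c.opInfo = some (k', i)) (ha : CompatAt D f a) (hif : CompatAt D f i) :
    ParentCompatAt D f i := by
  obtain ⟨z, K₁, o₁, k₁, hz, hmz, hK₁, ho₁, hstuck⟩ :=
    exists_stuck (fun _ _ _ => step_of_oneRedChild (P := P)) hsn hf ha.mem
  have hlz := hf.reduces hz
  have hlw := hf.reduces hw
  obtain ⟨v, hzv, hwv⟩ := reduces_join hsn hz hw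
  obtain ⟨K₂, o₂, k₂, hK₂, ho₂⟩ := hlw.exists_op hwv hK ho
  obtain ⟨rfl, c₂, hc₂, hi₂⟩ := hlw.persistent_opInfo hwv hK ho hc hi hK₂ ho₂
  obtain rfl := hlz.opKind hzv hK₁ ho₁ hK₂ ho₂
  have hlt : j < (subs o₁).length := by
    rw [length_subs ho₁, ← length_subs ho]
    exact (List.getElem?_eq_some_iff.1 hc).1
  have hc₁ := List.getElem?_eq_getElem hlt
  -- The child of `o₁` is stuck, so its root symbol in `z` is the one found in `v`, namely the
  -- operator with identifier `i`.
  have hs := stuck_children (by simp [opInfo_erase, ho₁]) hstuck hj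
    (c := (subs o₁)[j].erase) (by simp [subs_erase, hc₁])
  rw [env_erase, headStuck_erase] at hs
  obtain ⟨-, c₃, _, hc₃, -, hi₃⟩ :=
    hlz.persistent hzv (persistent_headStuck _) hK₁ ho₁ hc₁ ⟨hs, rfl⟩ hK₂ ho₂
  cases hc₂.symm.trans hc₃
  exact parentCompatAt_of_not_lt hD hf hz (hex _ hmz) (hif.reduces hD hf hz)
    ⟨K₁, o₁, _, a, j, _, k', hK₁, ho₁,
      (compatAt_iff hlz.1 hK₁ ho₁).1 (ha.reduces hD hf hz), hc₁, hi₃.symm.trans hi₂⟩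

theorem mem_reductions {e e' : Expr Unit} : e' ∈ reductions P e ↔ Reduces P e e' := by
  simp only [reductions, Set.mem_iUnion]
  constructor
  · rintro ⟨n, hn⟩
    induction n generalizing e' with
    | zero => cases hn; exact .refl
    | succ n ih =>
      obtain ⟨e₁, h₁, h₂⟩ := hn
      exact (ih h₁).tail h₂
  · intro h
    induction h with
    | refl => exact ⟨0, rfl⟩
    | tail _ h ih =>
      obtain ⟨n, hn⟩ := ih
      exact ⟨n + 1, _, hn, h⟩

end

end QIR

-- Combination of the two passes

theorem theorem6 (P : QIR.Prims) (D : QIR.Database) (hD : QIR.StableCompatibility P D)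
    (e : QIR.Expr Unit) (hsn : QIR.StronglyNormalizing P e) (hfix : QIR.FixedOperators P e) :
    ∃ Φ : ℕ, QIR.minRed P D Φ e ∈ QIR.minReductions P D e := by
  open QIR in
  obtain ⟨f, hlab⟩ := exists_isLabelling e
  have hf := linear_of_fixedOperators hlab hfix
  obtain rfl := hlab.1
  have hacc : Acc (fun a b => Step P b a) f := acc_of_stronglyNormalizing hsn
  have hc (K o y) : oneRedConfig P K o = some y → _ := step_of_oneRedConfig (P := P)
  have hch (K o y) : oneRedChild P K o = some y → _ := step_of_oneRedChild (P := P)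
  -- A bound for mixed sequences of both kinds of moves also holds at the starting point of the
  -- second pass, so one fuel value serves both passes.
  obtain ⟨n, hn⟩ := exists_bounded
    (r := fun x y => Move (oneRedConfig P) x y ∨ Move (oneRedChild P) x y)
    (fun x => (finite_move _ x).union (finite_move _ x)) (x := f.erase)
    (Subrelation.accessible (fun h => h.elim (Move.step hc) (Move.step hch)) hsn)
  refine ⟨n + 1, ?_⟩
  obtain ⟨hm₁, hex₁⟩ := passResult_spec (D := D) (hn.of_le fun _ _ h => .inl h)
    (Nat.lt_succ_self n)
  obtain ⟨hm₂, hex₂⟩ := passResult_spec (D := D)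
    ((hn.reflTransGen (Relation.ReflTransGen.mono (fun _ _ h => .inl h) _ _ hm₁)).of_le
      fun _ _ h => .inr h) (Nat.lt_succ_self n)
  rw [minRed]
  generalize passResult D (oneRedConfig P) (n + 1) f.erase = y₁ at *
  generalize passResult D (oneRedChild P) (n + 1) y₁ = y₂ at *
  obtain ⟨f₁, h₁, rfl⟩ := (reduces_of_moves hc hm₁).lift
  obtain ⟨f₂, h₂, rfl⟩ := (reduces_of_moves hch hm₂).lift
  have hf₁ := hf.reduces h₁
  have hf₂ := hf₁.reduces h₂
  have acc {g : Expr ℕ} (h : Reduces P f g) : Acc (fun a b => Step P b a) g := by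
    induction h with
    | refl => exact hacc
    | tail _ h ih => exact ih.inv h
  refine ⟨mem_reductions.2 (Reduces.erase (h₁.trans h₂)), fun m hm => ?_⟩
  obtain ⟨g, hg, rfl⟩ := (mem_reductions.1 hm).lift
  -- The competitor `g` is no better than the common reduct `w`, so only `w` has to be compared with
  -- the result `f₂`.
  obtain ⟨w, hw, hgw⟩ := reduces_join hacc (h₁.trans h₂) hg
  refine le_trans ?_ (measure_le_of_reduces hD (hf.reduces hg) hgw)
  -- Exhaustion for the first pass is known at `f₁` and not at `f₂`; what it gives at `f₁` is then
  -- carried to `f₂` by monotonicity.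
  have compat (i : ℕ) (hi : CompatAt D w i) : CompatAt D f₁ i := by
    obtain ⟨K, o, k, hK, ho, hcomp⟩ := hi
    exact (reflect_of_exhausted_config hD (acc h₁) hf₁ hex₁ (h₂.trans hw) hK ho hcomp).1
  have compat' (i : ℕ) (hi : CompatAt D w i) : CompatAt D f₂ i := (compat i hi).reduces hD hf₁ h₂
  refine measure_le_of_reflect hD hf₂ hw compat' fun i hi hp => ?_
  obtain ⟨K, o, k, a, j, c, k', hK, ho, hcomp, hcj, hci⟩ := hp
  -- The first pass accounts for operators that are configurations of their parent, the second for
  -- those that are children.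
  by_cases hj : j < k.numConfigs
  · exact ((reflect_of_exhausted_config hD (acc h₁) hf₁ hex₁ (h₂.trans hw) hK ho hcomp).2
      j hj c k' i hcj hci (compat i hi)).reduces hD hf₁ h₂
  · exact reflect_of_exhausted_child hD (acc (h₁.trans h₂)) hf₂ hex₂ hw hK ho (not_lt.1 hj) hcj hci
      (compat' a ⟨K, o, k, hK, ho, hcomp⟩) (compat' i hi)
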